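/- **Theorem 3.6 (Clark–Ocone bounds).** Let $(\Omega,\mathcal A,\mathbb P)$ be a probability space and let $\mathbb X=(X_k)_{k\in\mathbb N}$ be a sequence of independent random variables on it, $X_k$ taking values in an arbitrary measurable space $(E_k,\mathcal B_k)$. Put $\mathcal F=\sigma(\mathbb X)$, $\mathcal F_k=\sigma(X_j:\,j\le k)$ and $\mathcal G_k=\sigma(X_j:\,j\neq k)$. For $k\in\mathbb N$ and $G\in L^1(\Omega,\mathcal F,\mathbb P)$ let $$D_kG:=G-\mathbb E[G\mid\mathcal G_k].$$ Let $\mathcal S$ be the set of all $G\in L^2(\Omega,\mathcal F,\mathbb P)$ that are $\mathcal F_n$-measurable for some $n\in\mathbb N$, let $\kappa$ be the counting measure on $\mathbb N$, and let $\mathrm{dom}(D)$ be the domain of the closure of the operator $G\mapsto(D_kG)_{k\in\mathbb N}$ from $\mathcal S\subseteq L^2(\Omega,\mathcal F,\mathbb P)$ to $L^2(\mathbb N\times\Omega,\mathcal P(\mathbb N)\otimes\mathcal F,\kappa\otimes\mathbb P)$. That is, $F\in\mathrm{dom}(D)$ if and only if $F\in L^2(\Omega,\mathcal F,\mathbb P)$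 and there are $G_n\in\mathcal S$ such that $G_n\to F$ in $L^2(\mathbb P)$ and $(D_kG_n)_{k\in\mathbb N}$ converges in $L^2(\kappa\otimes\mathbb P)$ as $n\to\infty$. Let $Z\sim N(0,1)$ and $$d_{\mathcal W}(F,Z)=\sup_{h}\bigl|\mathbb E[h(F)]-\mathbb E[h(Z)]\bigr|,\qquad d_{\mathcal K}(F,Z)=\sup_{z\in\mathbb R}\bigl|\mathbb P(F\le z)-\mathbb P(Z\le z)\bigr|,$$ where the first supremum is over all $h:\mathbb R\to\mathbb R$ with $|h(x)-h(y)|\le|x-y|$ for all $x,y\in\mathbb R$. Suppose that $F\in\mathrm{dom}(D)$ and $\mathbb E[F]=0$. Then the series $\sum_k (D_k\mathbb E[F\mid\mathcal F_k])\,D_kF$ and $\sum_k\mathbb E\bigl[|D_k\mathbb E[F\mid\mathcal F_k]|\,\big|\,\mathcal G_k\bigr]D_kF$ converge absolutely almost surely, and, in $[0,\infty]$, $$d_{\mathcal W}(F,Z)\le\sqrt{\tfrac2\pi}\;\mathbb E\Bigl|1-\sum_{k}\bigl(D_k\mathbb E[F\mid\mathcal F_k]\bigr)D_kF\Bigr|+\sum_{k}\mathbb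 E\Bigl[\bigl|D_k\mathbb E[F\mid\mathcal F_k]\bigr|\,(D_kF)^2\Bigr]$$ and $$d_{\mathcal K}(F,Z)\le\mathbb E\Bigl|1-\sum_{k}\bigl(D_k\mathbb E[F\mid\mathcal F_k]\bigr)D_kF\Bigr|+2\sum_{k}\mathbb E\Bigl|\bigl(D_k\bigl|D_k\mathbb E[F\mid\mathcal F_k]\bigr|\bigr)\,D_kF\Bigr|+2\,\mathbb E\Bigl|\sum_{k}\mathbb E\bigl[\,|D_k\mathbb E[F\mid\mathcal F_k]|\,\big|\,\mathcal G_k\bigr]D_kF\Bigr|.$$ Here all sums run over $k\in\mathbb N$. -/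

import Mathlib

open MeasureTheory ProbabilityTheory Filter Topology
open scoped ENNReal

namespace ProductMalliavin

noncomputable section

/-- The sigma-field `σ(X_j, j ∈ M)` on `Ω` generated by the coordinates with index in `M`. -/
@[reducible] def sigmaOf {Ω : Type*} {E : ℕ → Type*} [∀ n, MeasurableSpace (E n)]
    (X : ∀ n, Ω → E n) (M : Set ℕ) : MeasurableSpace Ω :=
  ⨆ j ∈ M, MeasurableSpace.comap (X j) inferInstance

/-- `D_k F = F - 𝔼[F | σ(X_j, j ≠ k)]`. -/
def D {Ω : Type*} [MeasurableSpace Ω] (P : Measure Ω) {E : ℕ → Type*}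
    [∀ n, MeasurableSpace (E n)] (X : ∀ n, Ω → E n) (k : ℕ) (F : Ω → ℝ) : Ω → ℝ :=
  fun ω => F ω - (P[F | sigmaOf X {k}ᶜ]) ω

/-- `F` belongs to `L²(Ω, σ(X_j, j ∈ M), P)` (up to almost sure equality). -/
def MemL2 {Ω : Type*} [MeasurableSpace Ω] (P : Measure Ω) {E : ℕ → Type*}
    [∀ n, MeasurableSpace (E n)] (X : ∀ n, Ω → E n) (M : Set ℕ) (F : Ω → ℝ) : Prop :=
  AEStronglyMeasurable[sigmaOf X M] F P ∧ MemLp F 2 P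

/-- Square-integrable cylindrical random variables: those depending on finitely many coordinates
only. -/
def Cylindrical {Ω : Type*} [MeasurableSpace Ω] (P : Measure Ω) {E : ℕ → Type*}
    [∀ n, MeasurableSpace (E n)] (X : ∀ n, Ω → E n) (F : Ω → ℝ) : Prop :=
  ∃ n : ℕ, MemL2 P X (Set.Iic n) F

/-- The squared norm `∑ₖ 𝔼[U_k²]` of a process `U = (U_k)` in `L²(κ ⊗ P)`, where `κ` is the
counting measure on the index set. -/
def processNormSq {Ω : Type*} [MeasurableSpace Ω] (P : Measure Ω) (U : ℕ → Ω → ℝ) : ℝ≥0∞ :=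
  ∑' k, ∫⁻ ω, ‖U k ω‖ₑ ^ 2 ∂P

/-- The domain of the Malliavin derivative, i.e. of the closure of the operator
`F ↦ (D_k F)_k`, which maps cylindrical random variables, a subspace of `L²(Ω, σ(X), P)`, to
processes in `L²(κ ⊗ P|σ(X))`: `F` is in the domain if some sequence of cylindrical random
variables `G_n` converges to `F` in `L²` while the processes `(D_k G_n)_k` converge in
`L²(κ ⊗ P|σ(X))` to some process `U`. -/
def MemDomD {Ω : Type*} [MeasurableSpace Ω] (P : Measure Ω) {E : ℕ → Type*}
    [∀ n, MeasurableSpace (E n)] (X : ∀ n, Ω → E n) (F : Ω → ℝ) : Prop :=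
  MemL2 P X Set.univ F ∧
  ∃ (G : ℕ → Ω → ℝ) (U : ℕ → Ω → ℝ),
    (∀ n, Cylindrical P X (G n)) ∧
    (∀ k, AEStronglyMeasurable[sigmaOf X Set.univ] (U k) P) ∧
    processNormSq P U < ∞ ∧
    Tendsto (fun n => eLpNorm (fun ω => G n ω - F ω) 2 P) atTop (𝓝 0) ∧
    Tendsto (fun n => processNormSq P (fun k ω => D P X k (G n) ω - U k ω)) atTop (𝓝 0)

/-- The random variable `D_k 𝔼[F | F_k]`, where `F_k = σ(X_j, j ≤ k)`. -/
def clarkOcone {Ω : Type*} [MeasurableSpace Ω] (P : Measure Ω) {E : ℕ → Type*}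
    [∀ n, MeasurableSpace (E n)] (X : ∀ n, Ω → E n) (F : Ω → ℝ) (k : ℕ) : Ω → ℝ :=
  D P X k (P[F | sigmaOf X (Set.Iic k)])

/-- The Wasserstein distance of two laws on `ℝ` with finite first moment:
`sup |∫ h dν - ∫ h dρ|` over all `h` with `|h x - h y| ≤ |x - y|`. -/
def wassersteinDist (ν ρ : Measure ℝ) : ℝ≥0∞ :=
  ⨆ (h : ℝ → ℝ) (_ : LipschitzWith 1 h), ENNReal.ofReal |(∫ x, h x ∂ν) - ∫ x, h x ∂ρ|

/-- The Kolmogorov distance of two probability laws on `ℝ`: the supremum distance of their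
distribution functions. -/
def kolmogorovDist (ν ρ : Measure ℝ) : ℝ≥0∞ :=
  ⨆ z : ℝ, ENNReal.ofReal |ν.real (Set.Iic z) - ρ.real (Set.Iic z)|

end

end ProductMalliavin

/-! Write c_k = D_k E[F | F_k]. By independence c_k = E[F | F_k] - E[F | F_{k-1}], so the c_k are
martingale increments summing to F, and E[F f(F)] = Σ_k E[c_k f(F)] for bounded continuous f
(`tendsto_sum_clarkOcone`). Moreover c_k is orthogonal to bounded G_k-measurable variables, in
particular to f(F - D_k F), because F - D_k F = E[F | G_k]. Hence E[c_k f(F)] = E[c_k (f(F) - f(F -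
D_k F))]. Expanding f at F, with u in the role of f' and R_k the first-order remainder, E[u(F) - F
f(F)] = E[(1 - Σ c_k D_k F) u(F)] - Σ E[c_k R_k], which yields `malliavin_stein_bound`. The series
make sense because Σ E[c_k²] ≤ E[F²] by orthogonality and Σ E[(D_k F)²] < ∞ on the domain of D.

The rest is Stein's method: insert solutions of u(x) - x f(x) = h(x) - E[h(Z)]. For the Wasserstein
distance h may be taken smooth, and `exists_stein_solution` provides |u| ≤ √(2/π) and |R_k| ≤ (D_k
F)². The bound on u comes from an Ornstein-Uhlenbeck integral, the one on the remainder from a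
closed formula, and uniqueness of bounded solutions identifies the two.

For the Kolmogorov distance u jumps at z, but |R_k| ≤ D_k F (g(F) - g(F - D_k F)) with the
increasing function g = `kolMono z`. Splitting |c_k| = D_k|c_k| + E[|c_k| | G_k], the first part
uses that g oscillates by at most 2. In the second the g(F - D_k F) term vanishes by orthogonality,
and what is left is summed under one expectation (`kolmogorov_remainder_le`). -/

namespace StdGaussian

noncomputable section

/-! ### Gaussian density, tail and tail moments. -/

/-- The density of the standard normal distribution. -/
def pdf (x : ℝ) : ℝ := gaussianPDFReal 0 1 x

/-- The upper tail of the standard normal distribution. -/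
def tail (x : ℝ) : ℝ := ∫ t in Set.Ioi x, pdf t

lemma pdf_eq (x : ℝ) : pdf x = (Real.sqrt (2 * Real.pi))⁻¹ * Real.exp (-x ^ 2 / 2) := by
  simp [pdf, gaussianPDFReal]

lemma pdf_pos (x : ℝ) : 0 < pdf x := gaussianPDFReal_pos 0 1 x one_ne_zero

lemma pdf_neg (x : ℝ) : pdf (-x) = pdf x := by simp [pdf_eq]

lemma hasDerivAt_pdf (x : ℝ) : HasDerivAt pdf (-(x * pdf x)) x := by
  have h1 : HasDerivAt (fun y : ℝ => -y ^ 2 / 2) (-x) x := by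
    have := ((hasDerivAt_pow 2 x).neg).div_const 2
    refine this.congr_deriv ?_
    norm_num
    ring
  have h2 := (h1.exp).const_mul (Real.sqrt (2 * Real.pi))⁻¹
  have h3 : pdf = fun y => (Real.sqrt (2 * Real.pi))⁻¹ * Real.exp (-y ^ 2 / 2) := funext pdf_eq
  rw [h3]
  refine h2.congr_deriv ?_
  ring

lemma continuous_pdf : Continuous pdf :=
  continuous_iff_continuousAt.2 fun x => (hasDerivAt_pdf x).continuousAt

lemma integral_gaussian (f : ℝ → ℝ) :
    ∫ x, f x ∂gaussianReal 0 1 = ∫ x, pdf x * f x :=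
  integral_gaussianReal_eq_integral_smul one_ne_zero

lemma integrable_gaussian_iff (f : ℝ → ℝ) :
    Integrable f (gaussianReal 0 1) ↔ Integrable fun x => pdf x * f x := by
  rw [gaussianReal_of_var_ne_zero 0 one_ne_zero,
    integrable_withDensity_iff_integrable_smul' (measurable_gaussianPDF 0 1)
      (ae_of_all _ fun _ => gaussianPDF_lt_top)]
  simp only [toReal_gaussianPDF, smul_eq_mul, pdf]

lemma integrable_pdf : Integrable pdf := integrable_gaussianPDFReal 0 1

lemma integrable_id_gaussian : Integrable (fun x : ℝ => x) (gaussianReal 0 1) :=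
  (memLp_id_gaussianReal' 1 (by simp)).integrable le_rfl

lemma integrable_sq_gaussian : Integrable (fun x : ℝ => x ^ 2) (gaussianReal 0 1) :=
  (memLp_id_gaussianReal' 2 (by simp)).integrable_sq

lemma integrable_pdf_mul_id : Integrable fun x => pdf x * x :=
  (integrable_gaussian_iff _).1 integrable_id_gaussian

lemma integrable_pdf_mul_sq : Integrable fun x => pdf x * x ^ 2 :=
  (integrable_gaussian_iff _).1 integrable_sq_gaussian

lemma tendsto_pdf_atTop : Tendsto pdf atTop (𝓝 0) := by
  refine tendsto_zero_of_hasDerivAt_of_integrableOn_Ioi (a := 0)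
    (fun x _ => hasDerivAt_pdf x) ?_ integrable_pdf.integrableOn
  refine (integrable_pdf_mul_id.neg.congr (ae_of_all _ fun x => ?_)).integrableOn
  simp [mul_comm]

lemma hasDerivAt_id_mul_pdf (x : ℝ) :
    HasDerivAt (fun y => y * pdf y) (pdf x - pdf x * x ^ 2) x := by
  refine ((hasDerivAt_id x).mul (hasDerivAt_pdf x)).congr_deriv ?_
  simp only [id]
  ring

lemma tendsto_id_mul_pdf_atTop : Tendsto (fun x => x * pdf x) atTop (𝓝 0) := by
  refine tendsto_zero_of_hasDerivAt_of_integrableOn_Ioi (a := 0)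
    (fun x _ => hasDerivAt_id_mul_pdf x) ?_ ?_
  · exact (integrable_pdf.sub integrable_pdf_mul_sq).integrableOn
  · exact (integrable_pdf_mul_id.congr (ae_of_all _ fun x => mul_comm _ _)).integrableOn

lemma integral_Ioi_pdf_mul_id (x : ℝ) : ∫ t in Set.Ioi x, pdf t * t = pdf x := by
  have h := integral_Ioi_of_hasDerivAt_of_tendsto' (a := x) (f := fun y => -pdf y)
    (f' := fun y => pdf y * y) (m := 0)
    (fun y _ => ((hasDerivAt_pdf y).neg).congr_deriv (by ring))
    integrable_pdf_mul_id.integrableOn (by simpa using tendsto_pdf_atTop.neg)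
  simpa using h

lemma integral_Ioi_pdf_mul_sq (x : ℝ) :
    ∫ t in Set.Ioi x, pdf t * t ^ 2 = x * pdf x + tail x := by
  have h := integral_Ioi_of_hasDerivAt_of_tendsto' (a := x) (f := fun y => -(y * pdf y))
    (f' := fun y => pdf y * y ^ 2 - pdf y) (m := 0)
    (fun y _ => ((hasDerivAt_id_mul_pdf y).neg).congr_deriv (by ring))
    (integrable_pdf_mul_sq.sub integrable_pdf).integrableOn
    (by simpa using tendsto_id_mul_pdf_atTop.neg)
  rw [integral_sub integrable_pdf_mul_sq.integrableOn integrable_pdf.integrableOn] at h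
  rw [tail]
  linarith

lemma integral_pdf : ∫ x, pdf x = 1 := integral_gaussianPDFReal_eq_one 0 one_ne_zero

lemma tail_nonneg (x : ℝ) : 0 ≤ tail x :=
  integral_nonneg fun t => (pdf_pos t).le

lemma tail_neg (x : ℝ) : tail (-x) = 1 - tail x := by
  have h1 : tail (-x) = ∫ t in Set.Iic x, pdf t := by
    rw [tail, ← integral_comp_neg_Iic]
    simp [pdf_neg]
  have h2 := intervalIntegral.integral_Iic_add_Ioi (b := x) (f := pdf) (μ := volume)
    integrable_pdf.integrableOn integrable_pdf.integrableOn
  rw [integral_pdf] at h2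
  rw [h1, tail]
  linarith

lemma tail_le_one (x : ℝ) : tail x ≤ 1 := by
  have := tail_nonneg (-x)
  rw [tail_neg] at this
  linarith

lemma hasDerivAt_integral_Ioi {f : ℝ → ℝ} (hf : Continuous f)
    (hi : ∀ a, IntegrableOn f (Set.Ioi a)) (x : ℝ) :
    HasDerivAt (fun y => ∫ t in Set.Ioi y, f t) (-f x) x := by
  have h1 : (fun y => ∫ t in Set.Ioi y, f t)
      = fun y => (∫ t in Set.Ioi 0, f t) - ∫ t in (0 : ℝ)..y, f t := by
    funext y
    have := intervalIntegral.integral_Ioi_sub_Ioi' (hi 0) (hi y)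
    linarith
  rw [h1]
  exact (intervalIntegral.integral_hasDerivAt_right (hf.intervalIntegrable _ _)
    hf.aestronglyMeasurable.stronglyMeasurableAtFilter hf.continuousAt).const_sub _

lemma hasDerivAt_tail (x : ℝ) : HasDerivAt tail (-pdf x) x :=
  hasDerivAt_integral_Ioi continuous_pdf (fun _ => integrable_pdf.integrableOn) x

lemma continuous_tail : Continuous tail :=
  continuous_iff_continuousAt.2 fun x => (hasDerivAt_tail x).continuousAt

/-- The first Gaussian tail moment `∫ (t - x)₊ φ(t) dt`. -/
def stopLoss (x : ℝ) : ℝ := pdf x - x * tail x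

/-- The second Gaussian tail moment `∫ (t - x)₊² φ(t) dt`. -/
def stopLossSq (x : ℝ) : ℝ := (1 + x ^ 2) * tail x - x * pdf x

/-- It is the integral of φ(t)(t - x) over t > x. Divided by φ(x), this is the Mills ratio bound
`id_mul_mills_le_one`. -/
lemma stopLoss_nonneg (x : ℝ) : 0 ≤ stopLoss x := by
  have h : stopLoss x = ∫ t in Set.Ioi x, (pdf t * t - pdf t * x) := by
    rw [integral_sub integrable_pdf_mul_id.integrableOn
      (integrable_pdf.mul_const x).integrableOn, integral_Ioi_pdf_mul_id, integral_mul_const,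
      stopLoss, tail]
    ring
  rw [h]
  refine setIntegral_nonneg measurableSet_Ioi fun t ht => ?_
  have := mul_le_mul_of_nonneg_left (le_of_lt (Set.mem_Ioi.1 ht)) (pdf_pos t).le
  linarith

/-- It is the integral of φ(t)(t - x)² over t > x. The sign gives the monotonicity of x ↦ x ·
`mills` x and makes the weights in the second derivative of `tailSol` nonnegative. -/
lemma stopLossSq_nonneg (x : ℝ) : 0 ≤ stopLossSq x := by
  have h : stopLossSq x
      = ∫ t in Set.Ioi x, (pdf t * t ^ 2 - pdf t * t * (2 * x) + pdf t * x ^ 2) := by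
    rw [integral_add (by
      exact (integrable_pdf_mul_sq.sub (integrable_pdf_mul_id.mul_const (2 * x))).integrableOn)
      (integrable_pdf.mul_const _).integrableOn,
      integral_sub integrable_pdf_mul_sq.integrableOn
      (integrable_pdf_mul_id.mul_const _).integrableOn, integral_mul_const, integral_mul_const,
      integral_Ioi_pdf_mul_id, integral_Ioi_pdf_mul_sq, ← tail, stopLossSq]
    ring
  rw [h]
  refine integral_nonneg fun t => ?_
  have := mul_nonneg (pdf_pos t).le (sq_nonneg (t - x))
  show 0 ≤ pdf t * t ^ 2 - pdf t * t * (2 * x) + pdf t * x ^ 2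
  linarith [show pdf t * (t - x) ^ 2 = pdf t * t ^ 2 - pdf t * t * (2 * x) + pdf t * x ^ 2 by ring]

lemma stopLoss_neg (x : ℝ) : stopLoss (-x) = pdf x + x * (1 - tail x) := by
  rw [stopLoss, pdf_neg, tail_neg]
  ring

lemma stopLossSq_neg (x : ℝ) :
    stopLossSq (-x) = (1 + x ^ 2) * (1 - tail x) + x * pdf x := by
  rw [stopLossSq, pdf_neg, tail_neg]
  ring

lemma hasDerivAt_stopLoss (x : ℝ) : HasDerivAt stopLoss (-tail x) x := by
  refine ((hasDerivAt_pdf x).sub ((hasDerivAt_id x).mul (hasDerivAt_tail x))).congr_deriv ?_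
  simp only [id]
  ring

lemma tendsto_stopLoss_atTop : Tendsto stopLoss atTop (𝓝 0) := by
  refine squeeze_zero' (Eventually.of_forall stopLoss_nonneg) ?_ tendsto_pdf_atTop
  filter_upwards [eventually_ge_atTop 0] with x hx
  have := mul_nonneg hx (tail_nonneg x)
  rw [stopLoss]
  linarith

lemma integrableOn_tail (x : ℝ) : IntegrableOn tail (Set.Ioi x) := by
  have := integrableOn_Ioi_deriv_of_nonpos' (a := x) (fun y _ => hasDerivAt_stopLoss y)
    (fun y _ => neg_nonpos.2 (tail_nonneg y)) tendsto_stopLoss_atTop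
  simpa using this.neg

lemma integral_Ioi_tail (x : ℝ) : ∫ t in Set.Ioi x, tail t = stopLoss x := by
  have := integral_Ioi_of_hasDerivAt_of_tendsto' (a := x) (fun y _ => hasDerivAt_stopLoss y)
    (integrableOn_tail x).neg tendsto_stopLoss_atTop
  rw [integral_neg] at this
  linarith

/-- Gaussian integration by parts: φg and its derivative φ(g' - xg) are both integrable on the line,
so the latter integrates to zero. -/
lemma integral_deriv_eq_integral_id_mul {g g' : ℝ → ℝ} (hg : ∀ x, HasDerivAt g (g' x) x)
    {C : ℝ} (hC : ∀ x, |g x| ≤ C) (hg' : Integrable g' (gaussianReal 0 1)) :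
    ∫ x, g' x ∂gaussianReal 0 1 = ∫ x, x * g x ∂gaussianReal 0 1 := by
  have hcont : Continuous g := continuous_iff_continuousAt.2 fun x => (hg x).continuousAt
  have hxg : Integrable (fun x => x * g x) (gaussianReal 0 1) :=
    integrable_id_gaussian.mul_bdd (c := C) hcont.aestronglyMeasurable (ae_of_all _ hC)
  have hgi : Integrable g (gaussianReal 0 1) :=
    Integrable.of_bound hcont.aestronglyMeasurable C (ae_of_all _ hC)
  have hd : ∀ x, HasDerivAt (fun y => pdf y * g y) (pdf x * g' x - pdf x * (x * g x)) x := by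
    intro x
    refine ((hasDerivAt_pdf x).mul (hg x)).congr_deriv ?_
    ring
  have h := integral_eq_zero_of_hasDerivAt_of_integrable hd
    (((integrable_gaussian_iff _).1 hg').sub ((integrable_gaussian_iff _).1 hxg))
    ((integrable_gaussian_iff _).1 hgi)
  rw [integral_sub ((integrable_gaussian_iff _).1 hg') ((integrable_gaussian_iff _).1 hxg)] at h
  rw [integral_gaussian, integral_gaussian]
  linarith

lemma integral_abs_gaussian : ∫ x, |x| ∂gaussianReal 0 1 = Real.sqrt (2 / Real.pi) := by
  rw [integral_gaussian]
  have hi : Integrable fun x => pdf x * |x| :=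
    (integrable_gaussian_iff _).1 integrable_id_gaussian.abs
  have h2 := intervalIntegral.integral_Iic_add_Ioi (b := 0) (f := fun x => pdf x * |x|)
    (μ := volume) hi.integrableOn hi.integrableOn
  have h3 : ∫ x in Set.Ioi 0, pdf x * |x| = pdf 0 := by
    rw [← integral_Ioi_pdf_mul_id]
    refine setIntegral_congr_fun measurableSet_Ioi fun x hx => ?_
    rw [abs_of_pos (Set.mem_Ioi.1 hx)]
  have h4 : ∫ x in Set.Iic 0, pdf x * |x| = pdf 0 := by
    have := integral_comp_neg_Iic 0 fun x => pdf x * |x|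
    rw [neg_zero, h3] at this
    simpa only [pdf_neg, abs_neg] using this
  rw [← h2, h3, h4, pdf_eq]
  have hpi := Real.pi_pos
  rw [Real.sqrt_div zero_le_two, Real.sqrt_mul zero_le_two]
  have h5 : Real.sqrt 2 * Real.sqrt 2 = 2 := Real.mul_self_sqrt zero_le_two
  have h6 : 0 < Real.sqrt Real.pi := Real.sqrt_pos.2 hpi
  have h7 : 0 < Real.sqrt 2 := by positivity
  simp only [ne_eq, OfNat.ofNat_ne_zero, not_false_eq_true, zero_pow, neg_zero, zero_div,
    Real.exp_zero, mul_one]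
  field_simp
  nlinarith

lemma measureReal_Iic (z : ℝ) : (gaussianReal 0 1).real (Set.Iic z) = tail (-z) := by
  have h1 : tail (-z) = ∫ t in Set.Iic z, pdf t := by
    rw [tail, ← integral_comp_neg_Iic]
    simp [pdf_neg]
  rw [Measure.real, gaussianReal_apply_eq_integral 0 one_ne_zero, h1]
  exact ENNReal.toReal_ofReal (integral_nonneg fun t => (pdf_pos t).le)

end

end StdGaussian

/-! ### Stein's equation for indicators of half-lines. -/

namespace StdGaussian

noncomputable section

/-- The bounded solution of Stein's equation for the indicator of `(-∞, z]`. -/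
def kolSol (z x : ℝ) : ℝ :=
  if x ≤ z then tail z * tail (-x) / pdf x else tail (-z) * tail x / pdf x

/-- The derivative of `kolSol z`, extended to `z` through Stein's equation. -/
def kolDeriv (z x : ℝ) : ℝ :=
  x * kolSol z x + (if x ≤ z then 1 else 0) - tail (-z)

/-- An increasing function that controls the oscillation of `kolDeriv z`. -/
def kolMono (z x : ℝ) : ℝ := x * kolSol z x + if x ≤ z then 0 else 1

/-- The Mills ratio. -/
def mills (x : ℝ) : ℝ := tail x / pdf x

lemma mills_nonneg (x : ℝ) : 0 ≤ mills x := div_nonneg (tail_nonneg x) (pdf_pos x).le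

lemma id_mul_mills_le_one (x : ℝ) : x * mills x ≤ 1 := by
  have h := stopLoss_nonneg x
  rw [stopLoss] at h
  rw [mills, ← mul_div_assoc, div_le_one (pdf_pos x)]
  linarith

lemma hasDerivAt_mills (x : ℝ) : HasDerivAt mills (x * mills x - 1) x := by
  refine ((hasDerivAt_tail x).div (hasDerivAt_pdf x) (pdf_pos x).ne').congr_deriv ?_
  have := (pdf_pos x).ne'
  rw [mills]
  field_simp
  ring

lemma continuous_mills : Continuous mills :=
  continuous_iff_continuousAt.2 fun x => (hasDerivAt_mills x).continuousAt

lemma monotone_id_mul_mills : Monotone fun x => x * mills x := by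
  have hd : ∀ x : ℝ, HasDerivAt (fun x => x * mills x) ((1 + x ^ 2) * mills x - x) x := by
    intro x
    refine ((hasDerivAt_id x).mul (hasDerivAt_mills x)).congr_deriv ?_
    simp only [id]
    ring
  refine monotone_of_deriv_nonneg (fun x => (hd x).differentiableAt) fun x => ?_
  rw [(hd x).deriv]
  have h := div_nonneg (stopLossSq_nonneg x) (pdf_pos x).le
  have hp := (pdf_pos x).ne'
  have : stopLossSq x / pdf x = (1 + x ^ 2) * mills x - x := by
    rw [stopLossSq, mills]
    field_simp
  linarith

lemma mills_neg (x : ℝ) : mills (-x) = tail (-x) / pdf x := by rw [mills, pdf_neg]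

lemma kolSol_of_le {z x : ℝ} (h : x ≤ z) : kolSol z x = tail z * mills (-x) := by
  rw [kolSol, if_pos h, mills_neg, mul_div_assoc]

lemma kolSol_of_ge {z x : ℝ} (h : z ≤ x) : kolSol z x = tail (-z) * mills x := by
  rcases h.eq_or_lt with rfl | h
  · rw [kolSol_of_le le_rfl, mills_neg, mills]
    ring
  · rw [kolSol, if_neg h.not_ge, mills, mul_div_assoc]

lemma continuous_kolSol (z : ℝ) : Continuous (kolSol z) := by
  have h : kolSol z = fun x => if x ≤ z then tail z * mills (-x) else tail (-z) * mills x := by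
    funext x
    split_ifs with h
    · exact kolSol_of_le h
    · exact kolSol_of_ge (not_le.1 h).le
  rw [h]
  refine Continuous.if_le ?_ ?_ continuous_id continuous_const ?_
  · exact continuous_const.mul (continuous_mills.comp continuous_neg)
  · exact continuous_const.mul continuous_mills
  · rintro x rfl
    rw [← kolSol_of_le le_rfl, ← kolSol_of_ge le_rfl]

lemma monotone_id_mul_mills_neg : Monotone fun x => x * mills (-x) := by
  intro x y hxy
  have := monotone_id_mul_mills (neg_le_neg hxy)
  simp only at this ⊢
  linarith

/-- On either side of z this is a nonnegative multiple of x · `mills` x or of x · `mills` (-x), both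
increasing; the branches agree at z. -/
lemma monotone_id_mul_kolSol (z : ℝ) : Monotone fun x => x * kolSol z x := by
  have h1 : ∀ x y, x ≤ y → y ≤ z → x * kolSol z x ≤ y * kolSol z y := by
    intro x y hxy hy
    rw [kolSol_of_le hy, kolSol_of_le (hxy.trans hy)]
    have := mul_le_mul_of_nonneg_left (monotone_id_mul_mills_neg hxy) (tail_nonneg z)
    simp only at this
    linarith
  have h2 : ∀ x y, x ≤ y → z ≤ x → x * kolSol z x ≤ y * kolSol z y := by
    intro x y hxy hx
    rw [kolSol_of_ge hx, kolSol_of_ge (hx.trans hxy)]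
    have := mul_le_mul_of_nonneg_left (monotone_id_mul_mills hxy) (tail_nonneg (-z))
    simp only at this
    linarith
  intro x y hxy
  rcases le_total y z with hy | hy
  · exact h1 x y hxy hy
  rcases le_total z x with hx | hx
  · exact h2 x y hxy hx
  exact (h1 x z hx le_rfl).trans (h2 z y hy le_rfl)

lemma monotone_kolMono (z : ℝ) : Monotone (kolMono z) := by
  intro x y hxy
  have h := monotone_id_mul_kolSol z hxy
  simp only at h
  rw [kolMono, kolMono]
  split_ifs with h1 h2 h2 <;> linarith

lemma id_mul_kolSol_le (z x : ℝ) : x * kolSol z x ≤ tail (-z) := by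
  refine (monotone_id_mul_kolSol z (le_max_left x z)).trans ?_
  beta_reduce
  rw [kolSol_of_ge (le_max_right x z)]
  have := mul_le_mul_of_nonneg_left (id_mul_mills_le_one (max x z)) (tail_nonneg (-z))
  linarith

lemma le_id_mul_kolSol (z x : ℝ) : -tail z ≤ x * kolSol z x := by
  refine le_trans ?_ (monotone_id_mul_kolSol z (min_le_left x z))
  beta_reduce
  rw [kolSol_of_le (min_le_right x z)]
  have := mul_le_mul_of_nonneg_left (id_mul_mills_le_one (-min x z)) (tail_nonneg z)
  linarith

/-- The values x · `kolSol z x` lie in [-`tail z`, `tail (-z)`], an interval of length one. So the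
derivative lies in [0, 1] for x ≤ z and in [-1, 0] beyond. -/
lemma abs_kolDeriv_le (z x : ℝ) : |kolDeriv z x| ≤ 1 := by
  have h1 := id_mul_kolSol_le z x
  have h2 := le_id_mul_kolSol z x
  have h3 := tail_neg z
  have h4 : z * kolSol z z = tail z * (z * mills (-z)) := by rw [kolSol_of_le le_rfl]; ring
  have h5 := tail_nonneg z
  have h6 := tail_nonneg (-z)
  rw [kolDeriv, abs_le]
  split_ifs with h
  · constructor
    · linarith
    · have := monotone_id_mul_kolSol z h
      have h7 := id_mul_kolSol_le z z
      simp only at this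
      linarith
  · constructor
    · have := monotone_id_mul_kolSol z (not_le.1 h).le
      have h7 := le_id_mul_kolSol z z
      simp only at this
      linarith
    · linarith

lemma abs_kolMono_le (z x : ℝ) : |kolMono z x| ≤ 2 := by
  have h1 := id_mul_kolSol_le z x
  have h2 := le_id_mul_kolSol z x
  have h3 := tail_le_one z
  have h4 := tail_le_one (-z)
  rw [kolMono, abs_le]
  split_ifs <;> constructor <;> linarith

/-- One unit comes from the range of x · `kolSol z x`, one from the jump at z. Using
`abs_kolMono_le` twice would only give 4. -/
lemma kolMono_sub_le (z x y : ℝ) : |kolMono z x - kolMono z y| ≤ 2 := by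
  have h1 := id_mul_kolSol_le z x
  have h2 := le_id_mul_kolSol z x
  have h1' := id_mul_kolSol_le z y
  have h2' := le_id_mul_kolSol z y
  have h3 := tail_neg z
  rw [kolMono, kolMono, abs_le]
  split_ifs <;> constructor <;> linarith

lemma antitone_mills : Antitone mills := by
  intro x y hxy
  refine antitoneOn_of_deriv_nonpos convex_univ continuous_mills.continuousOn
    (fun y _ => (hasDerivAt_mills y).differentiableAt.differentiableWithinAt) (fun y _ => ?_)
    (Set.mem_univ x) (Set.mem_univ y) hxy
  rw [(hasDerivAt_mills y).deriv]
  linarith [id_mul_mills_le_one y]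

/-- The Mills ratio decreases, so the maximum sits at z. Only boundedness matters later; the
constant does not enter the final estimate. -/
lemma abs_kolSol_le (z x : ℝ) : |kolSol z x| ≤ kolSol z z := by
  have h1 := tail_nonneg z
  have h2 := tail_nonneg (-z)
  rcases le_total x z with h | h
  · rw [kolSol_of_le h, kolSol_of_le le_rfl, abs_of_nonneg (mul_nonneg h1 (mills_nonneg _))]
    exact mul_le_mul_of_nonneg_left (antitone_mills (neg_le_neg h)) h1
  · rw [kolSol_of_ge h, kolSol_of_ge le_rfl, abs_of_nonneg (mul_nonneg h2 (mills_nonneg _))]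
    exact mul_le_mul_of_nonneg_left (antitone_mills h) h2

lemma hasDerivAt_kolSol {z x : ℝ} (hx : x ≠ z) : HasDerivAt (kolSol z) (kolDeriv z x) x := by
  have h3 := tail_neg z
  rcases lt_or_gt_of_ne hx with h | h
  · have h1 : HasDerivAt (fun y => tail z * mills (-y)) (kolDeriv z x) x := by
      refine (((hasDerivAt_mills (-x)).comp x (hasDerivAt_neg x)).const_mul (tail z)).congr_deriv ?_
      rw [kolDeriv, if_pos h.le, kolSol_of_le h.le]
      linear_combination h3
    refine h1.congr_of_eventuallyEq ?_
    filter_upwards [eventually_lt_nhds h] with y hy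
    exact kolSol_of_le hy.le
  · have h1 : HasDerivAt (fun y => tail (-z) * mills y) (kolDeriv z x) x := by
      refine ((hasDerivAt_mills x).const_mul (tail (-z))).congr_deriv ?_
      rw [kolDeriv, if_neg h.not_ge, kolSol_of_ge (le_of_lt h)]
      ring
    refine h1.congr_of_eventuallyEq ?_
    filter_upwards [eventually_gt_nhds h] with y hy
    exact kolSol_of_ge (le_of_lt hy)

lemma measurable_kolDeriv (z : ℝ) : Measurable (kolDeriv z) := by
  unfold kolDeriv
  exact ((measurable_id.mul (continuous_kolSol z).measurable).add
    (Measurable.ite measurableSet_Iic measurable_const measurable_const)).sub_const _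

/-- `kolDeriv z` is, up to a constant, an increasing function plus a decreasing indicator. `kolMono
z` replaces the latter by the increasing complementary indicator, so its increments dominate. -/
lemma abs_kolDeriv_sub_le {z x y t : ℝ} (ht : t ∈ Set.uIcc x y) :
    |kolDeriv z t - kolDeriv z y| ≤ |kolMono z y - kolMono z x| := by
  have key : ∀ u v, u ≤ v → |kolDeriv z u - kolDeriv z v| ≤ kolMono z v - kolMono z u := by
    intro u v huv
    have h := monotone_id_mul_kolSol z huv
    simp only at h
    rw [kolDeriv, kolDeriv, kolMono, kolMono, abs_le]
    split_ifs with h1 h2 h2 <;> constructor <;> linarith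
  rcases le_total x y with h | h
  · rw [Set.uIcc_of_le h] at ht
    have := monotone_kolMono z ht.1
    exact (key t y ht.2).trans ((by linarith : _ ≤ kolMono z y - kolMono z x).trans (le_abs_self _))
  · rw [Set.uIcc_of_ge h] at ht
    have := monotone_kolMono z ht.2
    rw [abs_sub_comm]
    exact (key y t ht.1).trans ((by linarith : _ ≤ -(kolMono z y - kolMono z x)).trans
      (neg_le_abs _))

lemma abs_kolSol_taylor_le (z y d : ℝ) :
    |kolSol z y - kolSol z (y - d) - kolDeriv z y * d|
      ≤ d * (kolMono z y - kolMono z (y - d)) := by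
  have hb : ∀ a b, IntervalIntegrable (kolDeriv z) volume a b := fun a b =>
    (intervalIntegrable_const (c := (1 : ℝ))).mono_fun
      (measurable_kolDeriv z).aestronglyMeasurable
      (ae_of_all _ fun x => by simpa using abs_kolDeriv_le z x)
  -- The fundamental theorem tolerates the single point z where differentiability is not available.
  have h1 : ∫ t in (y - d)..y, kolDeriv z t = kolSol z y - kolSol z (y - d) :=
    integral_eq_of_hasDerivAt_off_countable _ _ (Set.countable_singleton z)
      (continuous_kolSol z).continuousOn (fun x hx => hasDerivAt_kolSol (fun h => hx.2 h)) (hb _ _)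
  have h2 : ∫ t in (y - d)..y, (kolDeriv z t - kolDeriv z y)
      = kolSol z y - kolSol z (y - d) - kolDeriv z y * d := by
    rw [intervalIntegral.integral_sub (hb _ _) intervalIntegrable_const, h1,
      intervalIntegral.integral_const, smul_eq_mul]
    ring
  have h3 := intervalIntegral.norm_integral_le_of_norm_le_const (a := y - d) (b := y)
    (f := fun t => kolDeriv z t - kolDeriv z y) (C := |kolMono z y - kolMono z (y - d)|)
    (fun t ht => abs_kolDeriv_sub_le (Set.uIoc_subset_uIcc ht))
  rw [h2, Real.norm_eq_abs] at h3
  refine h3.trans_eq ?_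
  rw [sub_sub_cancel, ← abs_mul, mul_comm]
  refine abs_of_nonneg ?_
  rcases le_total 0 d with h | h
  · have := monotone_kolMono z (show y - d ≤ y by linarith)
    exact mul_nonneg h (by linarith)
  · have := monotone_kolMono z (show y ≤ y - d by linarith)
    exact mul_nonneg_of_nonpos_of_nonpos h (by linarith)

end

end StdGaussian

/-! ### Ornstein-Uhlenbeck form of the Stein solution and the bound on its derivative. -/

namespace StdGaussian

noncomputable section

/-- The product of Lebesgue measure on the quarter circle of angles and the standard normal
distribution. -/
def arcMeasure : Measure (ℝ × ℝ) :=
  (volume.restrict (Set.Ioc 0 (Real.pi / 2))).prod (gaussianReal 0 1)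

instance : IsFiniteMeasure arcMeasure := by unfold arcMeasure; infer_instance

/-- The rotation `x sin θ + z cos θ`. -/
def rot (x : ℝ) (w : ℝ × ℝ) : ℝ := x * Real.sin w.1 + w.2 * Real.cos w.1

lemma continuous_rot (x : ℝ) : Continuous (rot x) := by unfold rot; fun_prop

lemma hasDerivAt_rot (x : ℝ) (w : ℝ × ℝ) : HasDerivAt (fun y => rot y w) (Real.sin w.1) x := by
  unfold rot
  simpa using ((hasDerivAt_id x).mul_const (Real.sin w.1)).add_const (w.2 * Real.cos w.1)

lemma integrable_arc_of_bound {f : ℝ × ℝ → ℝ} (hf : Continuous f) {C : ℝ}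
    (hC : ∀ w, |f w| ≤ C) : Integrable f arcMeasure :=
  Integrable.of_bound hf.aestronglyMeasurable C (ae_of_all _ hC)

lemma integrable_arc_snd : Integrable (fun w : ℝ × ℝ => w.2) arcMeasure :=
  (integrable_id_gaussian).comp_snd _

lemma integrable_arc_mul_snd {f : ℝ × ℝ → ℝ} (hf : Continuous f) {C : ℝ}
    (hC : ∀ w, |f w| ≤ C) : Integrable (fun w => w.2 * f w) arcMeasure :=
  integrable_arc_snd.mul_bdd (c := C) hf.aestronglyMeasurable (ae_of_all _ hC)

lemma abs_mul_mul_le {a b c d : ℝ} (ha : |a| ≤ 1) (hb : |b| ≤ 1) (hc : |c| ≤ d) :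
    |a * (b * c)| ≤ d := by
  rw [abs_mul, abs_mul]
  have hd : 0 ≤ d := (abs_nonneg c).trans hc
  calc |a| * (|b| * |c|) ≤ 1 * (1 * d) := by gcongr
    _ = d := by ring

lemma abs_mul_le' {a c d : ℝ} (ha : |a| ≤ 1) (hc : |c| ≤ d) : |a * c| ≤ d := by
  simpa using abs_mul_mul_le (b := 1) ha (by simp) hc

/-- The bounded solution of Stein's equation for a test function with derivative `k`, in its
Ornstein-Uhlenbeck representation. -/
def ouSol (k : ℝ → ℝ) (x : ℝ) : ℝ := -∫ w, Real.cos w.1 * k (rot x w) ∂arcMeasure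

variable {h k l : ℝ → ℝ} {C : ℝ}

lemma integral_arc (f : ℝ × ℝ → ℝ) (hf : Integrable f arcMeasure) :
    ∫ w, f w ∂arcMeasure
      = ∫ θ in (0 : ℝ)..(Real.pi / 2), ∫ z, f (θ, z) ∂gaussianReal 0 1 := by
  rw [intervalIntegral.integral_of_le (by positivity), arcMeasure, integral_prod f hf]

lemma integral_arc_mul (f g : ℝ → ℝ) :
    ∫ w, f w.1 * g w.2 ∂arcMeasure
      = (∫ θ in (0 : ℝ)..(Real.pi / 2), f θ) * ∫ z, g z ∂gaussianReal 0 1 := by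
  rw [intervalIntegral.integral_of_le (by positivity), arcMeasure]
  exact integral_prod_mul f g

/-- The cosine is nonnegative on the quarter circle and has integral one there. -/
lemma abs_ouSol_le (hk1 : ∀ x, |k x| ≤ 1) (x : ℝ) : |ouSol k x| ≤ 1 := by
  rw [ouSol, abs_neg]
  have h1 : |∫ w, Real.cos w.1 * k (rot x w) ∂arcMeasure| ≤ ∫ w, Real.cos w.1 * 1 ∂arcMeasure := by
    rw [← Real.norm_eq_abs]
    refine norm_integral_le_of_norm_le
      (integrable_arc_of_bound (f := fun w => Real.cos w.1 * 1) (C := 1) (by fun_prop)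
        fun w => ?_) ?_
    · simpa using Real.abs_cos_le_one w.1
    · have : ∀ᵐ w ∂arcMeasure, w.1 ∈ Set.Ioc (0 : ℝ) (Real.pi / 2) :=
        Measure.quasiMeasurePreserving_fst.ae (ae_restrict_mem measurableSet_Ioc)
      filter_upwards [this] with w hw
      have hc : 0 ≤ Real.cos w.1 :=
        Real.cos_nonneg_of_mem_Icc ⟨by linarith [hw.1, Real.pi_pos], hw.2⟩
      rw [Real.norm_eq_abs, abs_mul, abs_of_nonneg hc]
      exact mul_le_mul_of_nonneg_left (hk1 _) hc
  refine h1.trans ?_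
  rw [integral_arc_mul Real.cos fun _ => 1]
  simp

/-- Gaussian integration by parts in the second variable at each fixed angle. It removes l, so that
the bound on the derivative of `ouSol k` does not involve C. -/
lemma integral_arc_cos_mul_deriv (hk : ∀ x, HasDerivAt k (l x) x) (hl : Continuous l)
    (hk1 : ∀ x, |k x| ≤ 1) (hlC : ∀ x, |l x| ≤ C) (x : ℝ) :
    ∫ w, Real.cos w.1 * (Real.sin w.1 * l (rot x w)) ∂arcMeasure
      = ∫ w, w.2 * (Real.sin w.1 * k (rot x w)) ∂arcMeasure := by
  have hkc : Continuous k := continuous_iff_continuousAt.2 fun x => (hk x).continuousAt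
  have hr := continuous_rot x
  rw [integral_arc _ (integrable_arc_of_bound (C := C) (by fun_prop) fun w =>
      abs_mul_mul_le (Real.abs_cos_le_one _) (Real.abs_sin_le_one _) (hlC _)),
    integral_arc _ (integrable_arc_mul_snd (C := 1) (by fun_prop) fun w =>
      abs_mul_le' (Real.abs_sin_le_one _) (hk1 _))]
  refine intervalIntegral.integral_congr fun θ _ => ?_
  refine integral_deriv_eq_integral_id_mul (C := 1)
    (g := fun z => Real.sin θ * k (rot x (θ, z)))
    (g' := fun z => Real.cos θ * (Real.sin θ * l (rot x (θ, z)))) (fun z => ?_)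
    (fun z => abs_mul_le' (Real.abs_sin_le_one _) (hk1 _)) ?_
  · have h1 : HasDerivAt (fun z => rot x (θ, z)) (Real.cos θ) z := by
      unfold rot
      simpa using ((hasDerivAt_id z).mul_const (Real.cos θ)).const_add (x * Real.sin θ)
    exact (((hk _).comp z h1).const_mul (Real.sin θ)).congr_deriv (by ring)
  · refine Integrable.of_bound (C := C) ?_ (ae_of_all _ fun z =>
      abs_mul_mul_le (Real.abs_cos_le_one _) (Real.abs_sin_le_one _) (hlC _))
    have : Continuous fun z : ℝ => (θ, z) := by fun_prop
    exact Continuous.aestronglyMeasurable (by fun_prop)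

lemma hasDerivAt_ouSol (hk : ∀ x, HasDerivAt k (l x) x) (hl : Continuous l)
    (hk1 : ∀ x, |k x| ≤ 1) (hlC : ∀ x, |l x| ≤ C) (x : ℝ) :
    HasDerivAt (ouSol k) (-∫ w, w.2 * (Real.sin w.1 * k (rot x w)) ∂arcMeasure) x := by
  have hkc : Continuous k := continuous_iff_continuousAt.2 fun x => (hk x).continuousAt
  rw [← integral_arc_cos_mul_deriv hk hl hk1 hlC]
  have hr := continuous_rot
  refine (hasDerivAt_integral_of_dominated_loc_of_deriv_le (μ := arcMeasure)
    (F := fun y w => Real.cos w.1 * k (rot y w)) (bound := fun _ => C)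
    (F' := fun y w => Real.cos w.1 * (Real.sin w.1 * l (rot y w)))
    univ_mem (Eventually.of_forall fun y => ?_) ?_ ?_ ?_ (integrable_const _) ?_).2.neg
  · have := hr y
    exact Continuous.aestronglyMeasurable (by fun_prop)
  · have := hr x
    exact integrable_arc_of_bound (C := 1) (by fun_prop) fun w =>
      abs_mul_le' (Real.abs_cos_le_one _) (hk1 _)
  · have := hr x
    exact Continuous.aestronglyMeasurable (by fun_prop)
  · exact ae_of_all _ fun w y _ =>
      abs_mul_mul_le (Real.abs_cos_le_one _) (Real.abs_sin_le_one _) (hlC _)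
  · exact ae_of_all _ fun w y _ =>
      (((hk _).comp y (hasDerivAt_rot y w)).const_mul (Real.cos w.1)).congr_deriv (by ring)

/-- The sine integrates to one over the quarter circle, and E|Z| = √(2/π) is the other factor. -/
lemma abs_integral_arc_le (hk1 : ∀ x, |k x| ≤ 1) (x : ℝ) :
    |∫ w, w.2 * (Real.sin w.1 * k (rot x w)) ∂arcMeasure| ≤ Real.sqrt (2 / Real.pi) := by
  have h1 : |∫ w, w.2 * (Real.sin w.1 * k (rot x w)) ∂arcMeasure|
      ≤ ∫ w, Real.sin w.1 * |w.2| ∂arcMeasure := by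
    rw [← Real.norm_eq_abs]
    refine norm_integral_le_of_norm_le (g := fun w : ℝ × ℝ => Real.sin w.1 * |w.2|) ?_ ?_
    · have := integrable_arc_snd.abs.mul_bdd (c := 1) (g := fun w : ℝ × ℝ => Real.sin w.1)
        (Continuous.aestronglyMeasurable (by fun_prop))
        (ae_of_all _ fun w => Real.abs_sin_le_one w.1)
      exact this.congr (ae_of_all _ fun w => mul_comm _ _)
    · have : ∀ᵐ w ∂arcMeasure, w.1 ∈ Set.Ioc (0 : ℝ) (Real.pi / 2) :=
        Measure.quasiMeasurePreserving_fst.ae (ae_restrict_mem measurableSet_Ioc)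
      filter_upwards [this] with w hw
      have hc : 0 ≤ Real.sin w.1 :=
        Real.sin_nonneg_of_mem_Icc ⟨hw.1.le, by linarith [hw.2, Real.pi_pos]⟩
      rw [Real.norm_eq_abs, abs_mul, abs_mul, abs_of_nonneg hc]
      have := mul_le_mul_of_nonneg_left (hk1 (rot x w)) (mul_nonneg (abs_nonneg w.2) hc)
      linarith
  refine h1.trans ?_
  rw [integral_arc_mul Real.sin fun z => |z|, integral_abs_gaussian]
  simp

lemma abs_sub_le_of_deriv (hh : ∀ x, HasDerivAt h (k x) x) (hk1 : ∀ x, |k x| ≤ 1) (x y : ℝ) :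
    |h x - h y| ≤ |x - y| := by
  have := (convex_univ (𝕜 := ℝ) (E := ℝ)).norm_image_sub_le_of_norm_hasDerivWithin_le (C := 1)
    (fun x _ => (hh x).hasDerivWithinAt) (fun x _ => hk1 x) (Set.mem_univ y) (Set.mem_univ x)
  simpa using this

lemma integrable_of_lipschitz {μ : Measure ℝ} [IsProbabilityMeasure μ]
    (hμ : Integrable (fun x => x) μ) (hc : Continuous h) (hL : ∀ x y, |h x - h y| ≤ |x - y|) :
    Integrable h μ := by
  refine ((integrable_const |h 0|).add hμ.abs).mono' hc.aestronglyMeasurable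
    (ae_of_all _ fun x => ?_)
  have h1 := hL x 0
  have h2 := abs_add_le (h x - h 0) (h 0)
  simp only [sub_add_cancel, sub_zero] at h1 h2
  simp only [Real.norm_eq_abs, Pi.add_apply]
  linarith

lemma integrable_of_deriv_bound (hh : ∀ x, HasDerivAt h (k x) x) (hk1 : ∀ x, |k x| ≤ 1) :
    Integrable h (gaussianReal 0 1) :=
  integrable_of_lipschitz integrable_id_gaussian
    (continuous_iff_continuousAt.2 fun x => (hh x).continuousAt) (abs_sub_le_of_deriv hh hk1)

/-- For fixed z, θ ↦ h(x sin θ + z cos θ) runs from h(z) at 0 to h(x) at π/2. Integrating its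
θ-derivative over the arc and then over z gives Stein's equation. -/
lemma ouSol_stein (hh : ∀ x, HasDerivAt h (k x) x) (hk : Continuous k) (hk1 : ∀ x, |k x| ≤ 1)
    (x : ℝ) :
    -∫ w, w.2 * (Real.sin w.1 * k (rot x w)) ∂arcMeasure
      = x * ouSol k x + (h x - ∫ z, h z ∂gaussianReal 0 1) := by
  have hr := continuous_rot x
  have hhi := integrable_of_deriv_bound hh hk1
  have hi1 : Integrable (fun w => Real.cos w.1 * k (rot x w)) arcMeasure :=
    integrable_arc_of_bound (C := 1) (by fun_prop) fun w =>
      abs_mul_le' (Real.abs_cos_le_one _) (hk1 _)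
  have hi2 : Integrable (fun w => w.2 * (Real.sin w.1 * k (rot x w))) arcMeasure :=
    integrable_arc_mul_snd (C := 1) (by fun_prop) fun w =>
      abs_mul_le' (Real.abs_sin_le_one _) (hk1 _)
  have h1 : ∀ z, ∫ θ in (0 : ℝ)..(Real.pi / 2),
      (x * (Real.cos θ * k (rot x (θ, z))) - z * (Real.sin θ * k (rot x (θ, z)))) = h x - h z := by
    intro z
    have hd : ∀ θ, HasDerivAt (fun θ => h (rot x (θ, z)))
        (x * (Real.cos θ * k (rot x (θ, z))) - z * (Real.sin θ * k (rot x (θ, z)))) θ := by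
      intro θ
      have h2 : HasDerivAt (fun θ => rot x (θ, z)) (x * Real.cos θ - z * Real.sin θ) θ := by
        unfold rot
        exact (((Real.hasDerivAt_sin θ).const_mul x).add
          ((Real.hasDerivAt_cos θ).const_mul z)).congr_deriv (by ring)
      exact ((hh _).comp θ h2).congr_deriv (by ring)
    have hcont : Continuous fun θ : ℝ => (θ, z) := by fun_prop
    rw [intervalIntegral.integral_eq_sub_of_hasDerivAt (fun θ _ => hd θ)
      (Continuous.intervalIntegrable (by fun_prop) _ _)]
    simp [rot]
  have h2 : ∫ w, (x * (Real.cos w.1 * k (rot x w)) - w.2 * (Real.sin w.1 * k (rot x w)))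
      ∂arcMeasure = h x - ∫ z, h z ∂gaussianReal 0 1 := by
    have hi3 : Integrable (fun w => x * (Real.cos w.1 * k (rot x w))
      - w.2 * (Real.sin w.1 * k (rot x w))) arcMeasure := (hi1.const_mul x).sub hi2
    rw [arcMeasure] at hi3 ⊢
    rw [integral_prod_symm _ hi3]
    simp only [intervalIntegral.integral_of_le (show (0 : ℝ) ≤ Real.pi / 2 by positivity)] at h1
    simp only [h1]
    rw [integral_sub (integrable_const _) hhi]
    simp
  rw [integral_sub (hi1.const_mul x) hi2, integral_const_mul] at h2
  rw [ouSol]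
  linarith

end

end StdGaussian

/-! ### Closed form of the Stein solution and its second-order bounds. -/

namespace StdGaussian

noncomputable section

/-- The integral of `k` against the Gaussian tail function over `(x, ∞)`. -/
def tailInt (k : ℝ → ℝ) (x : ℝ) : ℝ := ∫ t in Set.Ioi x, tail t * k t

variable {h k l : ℝ → ℝ} {C : ℝ}

lemma integrableOn_tail_mul (hk : Continuous k) (hk1 : ∀ x, |k x| ≤ 1) (x : ℝ) :
    IntegrableOn (fun t => tail t * k t) (Set.Ioi x) :=
  (integrableOn_tail x).mul_bdd (c := 1) hk.aestronglyMeasurable (ae_of_all _ hk1)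

lemma hasDerivAt_tailInt (hk : Continuous k) (hk1 : ∀ x, |k x| ≤ 1) (x : ℝ) :
    HasDerivAt (tailInt k) (-(tail x * k x)) x :=
  hasDerivAt_integral_Ioi (continuous_tail.mul hk) (integrableOn_tail_mul hk hk1) x

lemma abs_tailInt_le (hk1 : ∀ x, |k x| ≤ 1) (x : ℝ) :
    |tailInt k x| ≤ stopLoss x := by
  rw [← integral_Ioi_tail]
  rw [← Real.norm_eq_abs, tailInt]
  refine norm_integral_le_of_norm_le (integrableOn_tail x) (ae_of_all _ fun t => ?_)
  rw [Real.norm_eq_abs, abs_mul, abs_of_nonneg (tail_nonneg t)]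
  exact mul_le_of_le_one_right (tail_nonneg t) (hk1 t)

/-- The part of the explicit Stein solution coming from the lower tail. -/
def lowerInt (k : ℝ → ℝ) (x : ℝ) : ℝ := tailInt (fun t => k (-t)) (-x)

lemma hasDerivAt_lowerInt (hk : Continuous k) (hk1 : ∀ x, |k x| ≤ 1) (x : ℝ) :
    HasDerivAt (lowerInt k) (tail (-x) * k x) x := by
  have h1 := (hasDerivAt_tailInt (k := fun t => k (-t)) (by fun_prop) (fun x => hk1 _) (-x)).comp
    x (hasDerivAt_neg x)
  refine h1.congr_deriv ?_
  simp

lemma abs_lowerInt_le (hk1 : ∀ x, |k x| ≤ 1) (x : ℝ) : |lowerInt k x| ≤ stopLoss (-x) :=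
  abs_tailInt_le (fun _ => hk1 _) _

/-- The bounded solution of Stein's equation for a test function with derivative `k`, in closed
form. -/
def tailSol (k : ℝ → ℝ) (x : ℝ) : ℝ :=
  -(mills x * lowerInt k x + mills (-x) * tailInt k x)

lemma hasDerivAt_tailSol (hk : Continuous k) (hk1 : ∀ x, |k x| ≤ 1) (x : ℝ) :
    HasDerivAt (tailSol k) (x * tailSol k x + (lowerInt k x - tailInt k x)) x := by
  have h1 := (hasDerivAt_mills x).mul (hasDerivAt_lowerInt hk hk1 x)
  have h2 := ((hasDerivAt_mills (-x)).comp x (hasDerivAt_neg x)).mul (hasDerivAt_tailInt hk hk1 x)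
  refine ((h1.add h2).neg).congr_deriv ?_
  have hm : mills x * tail (-x) = mills (-x) * tail x := by
    rw [mills_neg, mills]
    ring
  rw [tailSol]
  simp only [Function.comp]
  linear_combination -(k x) * hm

/-- The extremal case is k = 1, that is h(x) = x, where the solution is the constant -1; `h3` is
that identity. -/
lemma abs_tailSol_le (hk1 : ∀ x, |k x| ≤ 1) (x : ℝ) : |tailSol k x| ≤ 1 := by
  have h1 := mul_le_mul_of_nonneg_left (abs_lowerInt_le hk1 x) (mills_nonneg x)
  have h2 := mul_le_mul_of_nonneg_left (abs_tailInt_le hk1 x) (mills_nonneg (-x))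
  have h3 : mills x * stopLoss (-x) + mills (-x) * stopLoss x = 1 := by
    have hp := (pdf_pos x).ne'
    rw [stopLoss_neg, stopLoss, mills_neg, tail_neg, mills]
    field_simp
    ring
  rw [tailSol, abs_neg]
  refine (abs_add_le _ _).trans ?_
  rw [abs_mul, abs_mul, abs_of_nonneg (mills_nonneg x), abs_of_nonneg (mills_nonneg (-x))]
  linarith

lemma hasDerivAt_lowerInt_sub_tailInt (hk : Continuous k) (hk1 : ∀ x, |k x| ≤ 1) (x : ℝ) :
    HasDerivAt (fun y => lowerInt k y - tailInt k y) (k x) x := by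
  refine ((hasDerivAt_lowerInt hk hk1 x).sub (hasDerivAt_tailInt hk hk1 x)).congr_deriv ?_
  rw [tail_neg]
  ring

/-- Both sides have derivative k. The constant is fixed because the left side has Gaussian mean
zero, by integration by parts applied to `tailSol k`. -/
lemma lowerInt_sub_tailInt (hh : ∀ x, HasDerivAt h (k x) x) (hk : Continuous k)
    (hk1 : ∀ x, |k x| ≤ 1) (x : ℝ) :
    lowerInt k x - tailInt k x = h x - ∫ z, h z ∂gaussianReal 0 1 := by
  have hd := hasDerivAt_lowerInt_sub_tailInt hk hk1
  have hi := integrable_of_deriv_bound hd hk1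
  have hhi := integrable_of_deriv_bound hh hk1
  have hc : ∀ y, h y = (lowerInt k y - tailInt k y) + (h 0 - (lowerInt k 0 - tailInt k 0)) := by
    intro y
    have hz : ∀ y, HasDerivAt (fun y => h y - (lowerInt k y - tailInt k y)) 0 y := fun y =>
      ((hh y).sub (hd y)).congr_deriv (sub_self _)
    have := is_const_of_deriv_eq_zero (fun y => (hz y).differentiableAt)
      (fun y => (hz y).deriv) y 0
    linarith
  have hsc : Continuous (tailSol k) :=
    continuous_iff_continuousAt.2 fun x => (hasDerivAt_tailSol hk hk1 x).continuousAt
  have hxs : Integrable (fun x => x * tailSol k x) (gaussianReal 0 1) :=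
    integrable_id_gaussian.mul_bdd (c := 1) hsc.aestronglyMeasurable
      (ae_of_all _ (abs_tailSol_le hk1))
  have h0 := integral_deriv_eq_integral_id_mul (hasDerivAt_tailSol hk hk1) (abs_tailSol_le hk1)
    (hxs.add hi)
  rw [integral_add hxs hi] at h0
  have h1 : ∫ z, h z ∂gaussianReal 0 1 = h 0 - (lowerInt k 0 - tailInt k 0) := by
    rw [integral_congr_ae (ae_of_all _ hc), integral_add hi (integrable_const _)]
    simp only [integral_const, probReal_univ, one_smul]
    linarith
  rw [h1, hc x]
  ring

/-- Bounded solutions of Stein's equation are unique. -/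
lemma stein_unique {f g r : ℝ → ℝ} (hf : ∀ x, HasDerivAt f (x * f x + r x) x)
    (hg : ∀ x, HasDerivAt g (x * g x + r x) x) (hf1 : ∀ x, |f x| ≤ 1) (hg1 : ∀ x, |g x| ≤ 1) :
    f = g := by
  -- The difference w of two solutions satisfies w' = xw, so φw is constant; as w is bounded and φ
  -- vanishes at infinity, the constant is zero.
  have hz : ∀ y, HasDerivAt (fun y => pdf y * (f y - g y)) 0 y := fun y =>
    ((hasDerivAt_pdf y).mul ((hf y).sub (hg y))).congr_deriv (by
      rw [Pi.sub_apply]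
      ring)
  have hc := is_const_of_deriv_eq_zero (fun y => (hz y).differentiableAt) (fun y => (hz y).deriv)
  have hlim : Tendsto (fun y => pdf y * (f y - g y)) atTop (𝓝 0) := by
    refine squeeze_zero_norm (a := fun y => pdf y * 2) (fun y => ?_) ?_
    · rw [Real.norm_eq_abs, abs_mul, abs_of_pos (pdf_pos y)]
      refine mul_le_mul_of_nonneg_left ?_ (pdf_pos y).le
      have := abs_sub (f y) (g y)
      linarith [hf1 y, hg1 y]
    · simpa using tendsto_pdf_atTop.mul_const 2
  funext x
  have h0 : pdf x * (f x - g x) = 0 := by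
    refine tendsto_nhds_unique ?_ hlim
    exact tendsto_const_nhds.congr fun y => hc x y
  rcases mul_eq_zero.1 h0 with h | h
  · exact absurd h (pdf_pos x).ne'
  · linarith

/-- Uniqueness transfers to the closed form the estimate that is visible on `ouSol k`. -/
lemma abs_tailSol_deriv_le (hh : ∀ x, HasDerivAt h (k x) x) (hk : ∀ x, HasDerivAt k (l x) x)
    (hl : Continuous l) (hk1 : ∀ x, |k x| ≤ 1) (hlC : ∀ x, |l x| ≤ C) (x : ℝ) :
    |x * tailSol k x + (lowerInt k x - tailInt k x)| ≤ Real.sqrt (2 / Real.pi) := by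
  have hkc : Continuous k := continuous_iff_continuousAt.2 fun x => (hk x).continuousAt
  have h1 : ouSol k = tailSol k := by
    refine stein_unique (r := fun x => h x - ∫ z, h z ∂gaussianReal 0 1) (fun y => ?_) (fun y => ?_)
      (abs_ouSol_le hk1) (abs_tailSol_le hk1)
    · rw [← ouSol_stein hh hkc hk1]
      exact hasDerivAt_ouSol hk hl hk1 hlC y
    · rw [← lowerInt_sub_tailInt hh hkc hk1]
      exact hasDerivAt_tailSol hkc hk1 y
  rw [lowerInt_sub_tailInt hh hkc hk1, ← h1, ← ouSol_stein hh hkc hk1, abs_neg]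
  exact abs_integral_arc_le hk1 x

lemma hasDerivAt_tailSol_deriv (hk : Continuous k) (hk1 : ∀ x, |k x| ≤ 1) (x : ℝ) :
    HasDerivAt (fun y => y * tailSol k y + (lowerInt k y - tailInt k y))
      (k x - stopLossSq x / pdf x * lowerInt k x - stopLossSq (-x) / pdf x * tailInt k x) x := by
  refine (((hasDerivAt_id x).mul (hasDerivAt_tailSol hk hk1 x)).add
    (hasDerivAt_lowerInt_sub_tailInt hk hk1 x)).congr_deriv ?_
  have hp := (pdf_pos x).ne'
  simp only [id]
  rw [tailSol, stopLossSq_neg, stopLossSq, mills_neg, tail_neg, mills]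
  field_simp
  ring

/-- For k = 1 the solution is constant and this expression vanishes, so the two nonnegative weighted
terms sum to one (`h3`). In general they contribute at most 1, and k itself at most 1. -/
lemma abs_tailSol_deriv2_le (hk1 : ∀ x, |k x| ≤ 1) (x : ℝ) :
    |k x - stopLossSq x / pdf x * lowerInt k x - stopLossSq (-x) / pdf x * tailInt k x| ≤ 2 := by
  have hp := pdf_pos x
  have hq1 := div_nonneg (stopLossSq_nonneg x) hp.le
  have hq2 := div_nonneg (stopLossSq_nonneg (-x)) hp.le
  have h1 := mul_le_mul_of_nonneg_left (abs_lowerInt_le hk1 x) hq1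
  have h2 := mul_le_mul_of_nonneg_left (abs_tailInt_le hk1 x) hq2
  have h3 : stopLossSq x / pdf x * stopLoss (-x) + stopLossSq (-x) / pdf x * stopLoss x = 1 := by
    rw [stopLoss_neg, stopLoss, stopLossSq_neg, stopLossSq]
    field_simp
    ring
  refine (abs_sub _ _).trans ((add_le_add_left (abs_sub _ _) _).trans ?_)
  rw [abs_mul, abs_mul, abs_of_nonneg hq1, abs_of_nonneg hq2]
  linarith [hk1 x]

/-- The function f + x² is convex, hence lies above its tangent at y; d² is what the added square
contributes. -/
lemma le_taylor_of_deriv2_le {f f' f'' : ℝ → ℝ} (hf : ∀ x, HasDerivAt f (f' x) x)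
    (hf' : ∀ x, HasDerivAt f' (f'' x) x) (h2 : ∀ x, -2 ≤ f'' x) (y d : ℝ) :
    f y - f (y - d) - f' y * d ≤ d ^ 2 := by
  have hg : ∀ x, HasDerivAt (fun x => f x + x ^ 2) (f' x + 2 * x) x := fun x =>
    ((hf x).add (hasDerivAt_pow 2 x)).congr_deriv (by simp)
  have hg' : ∀ x, HasDerivAt (fun x => f' x + 2 * x) (f'' x + 2) x := fun x =>
    ((hf' x).add ((hasDerivAt_id x).const_mul 2)).congr_deriv (by simp)
  have hmono : Monotone fun x => f' x + 2 * x :=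
    monotone_of_deriv_nonneg (fun x => (hg' x).differentiableAt) fun x => by
      rw [(hg' x).deriv]
      linarith [h2 x]
  rcases lt_trichotomy d 0 with hd | rfl | hd
  · obtain ⟨c, hc, hce⟩ := exists_hasDerivAt_eq_slope (fun x => f x + x ^ 2)
      (fun x => f' x + 2 * x) (a := y) (b := y - d) (by linarith)
      (fun x _ => (hg x).continuousAt.continuousWithinAt) (fun x _ => hg x)
    have := hmono hc.1.le
    beta_reduce at this
    rw [hce, le_div_iff₀ (by linarith)] at this
    nlinarith
  · simp
  · obtain ⟨c, hc, hce⟩ := exists_hasDerivAt_eq_slope (fun x => f x + x ^ 2)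
      (fun x => f' x + 2 * x) (a := y - d) (b := y) (by linarith)
      (fun x _ => (hg x).continuousAt.continuousWithinAt) (fun x _ => hg x)
    have := hmono hc.2.le
    beta_reduce at this
    rw [hce, div_le_iff₀ (by linarith)] at this
    nlinarith

/-- Stein's equation for a twice continuously differentiable Lipschitz function has a solution
with the classical bounds on its derivatives. -/
theorem exists_stein_solution (hh : ∀ x, HasDerivAt h (k x) x) (hk : ∀ x, HasDerivAt k (l x) x)
    (hl : Continuous l) (hk1 : ∀ x, |k x| ≤ 1) (hlC : ∀ x, |l x| ≤ C) :
    ∃ f u : ℝ → ℝ, Continuous f ∧ Continuous u ∧ (∀ x, |f x| ≤ 1) ∧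
      (∀ x, |u x| ≤ Real.sqrt (2 / Real.pi)) ∧
      (∀ x, u x - x * f x = h x - ∫ z, h z ∂gaussianReal 0 1) ∧
      ∀ y d, |f y - f (y - d) - u y * d| ≤ d ^ 2 := by
  have hkc : Continuous k := continuous_iff_continuousAt.2 fun x => (hk x).continuousAt
  have h1 := hasDerivAt_tailSol hkc hk1
  have h2 := hasDerivAt_tailSol_deriv hkc hk1
  have h3 := abs_tailSol_deriv2_le hk1
  refine ⟨tailSol k, fun x => x * tailSol k x + (lowerInt k x - tailInt k x),
    continuous_iff_continuousAt.2 fun x => (h1 x).continuousAt,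
    continuous_iff_continuousAt.2 fun x => (h2 x).continuousAt, abs_tailSol_le hk1,
    abs_tailSol_deriv_le hh hk hl hk1 hlC, fun x => ?_, fun y d => abs_le.2 ⟨?_, ?_⟩⟩
  · rw [← lowerInt_sub_tailInt hh hkc hk1]
    ring
  · have := le_taylor_of_deriv2_le (fun x => (h1 x).neg) (fun x => (h2 x).neg)
      (fun x => neg_le_neg (abs_le.1 (h3 x)).2) y d
    simp only [Pi.neg_apply] at this
    linarith
  · exact le_taylor_of_deriv2_le h1 h2 (fun x => (abs_le.1 (h3 x)).1) y d

/-! ### Smoothing of Lipschitz functions. -/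

/-- The moving average of `h` over `[x, x + ε]`. -/
def movAvg (ε : ℝ) (h : ℝ → ℝ) (x : ℝ) : ℝ := ε⁻¹ * ∫ t in x..(x + ε), h t

lemma hasDerivAt_movAvg (hc : Continuous h) (ε x : ℝ) :
    HasDerivAt (movAvg ε h) (ε⁻¹ * (h (x + ε) - h x)) x := by
  have h1 : movAvg ε h
      = fun y => ε⁻¹ * ((∫ t in (0 : ℝ)..(y + ε), h t) - ∫ t in (0 : ℝ)..y, h t) := by
    funext y
    rw [movAvg, intervalIntegral.integral_interval_sub_left (hc.intervalIntegrable _ _)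
      (hc.intervalIntegrable _ _)]
  have h2 : ∀ y, HasDerivAt (fun y => ∫ t in (0 : ℝ)..y, h t) (h y) y := fun y =>
    intervalIntegral.integral_hasDerivAt_right (hc.intervalIntegrable _ _)
      hc.aestronglyMeasurable.stronglyMeasurableAtFilter hc.continuousAt
  rw [h1]
  exact (((h2 (x + ε)).comp_add_const x ε).sub (h2 x)).const_mul _

lemma abs_movAvg_sub_le (hc : Continuous h) {ε : ℝ} (hε : 0 < ε)
    (hL : ∀ x y, |h x - h y| ≤ |x - y|) (x : ℝ) : |movAvg ε h x - h x| ≤ ε := by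
  have h1 : movAvg ε h x - h x = ε⁻¹ * ∫ t in x..(x + ε), (h t - h x) := by
    rw [movAvg, intervalIntegral.integral_sub (hc.intervalIntegrable _ _)
      intervalIntegrable_const, intervalIntegral.integral_const, smul_eq_mul]
    field_simp
    ring
  have h2 := intervalIntegral.norm_integral_le_of_norm_le_const (a := x) (b := x + ε)
    (f := fun t => h t - h x) (C := ε) fun t ht => by
      rw [Set.uIoc_of_le (by linarith)] at ht
      refine (hL t x).trans ?_
      rw [abs_of_pos (by linarith [ht.1])]
      linarith [ht.2]
  rw [h1, abs_mul, abs_of_pos (inv_pos.2 hε), inv_mul_le_iff₀ hε]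
  simpa [abs_of_pos hε] using h2

lemma abs_movAvg_deriv_le {ε : ℝ} (hε : 0 < ε) (hL : ∀ x y, |h x - h y| ≤ |x - y|) (x : ℝ) :
    |ε⁻¹ * (h (x + ε) - h x)| ≤ 1 := by
  have := hL (x + ε) x
  rw [add_sub_cancel_left, abs_of_pos hε] at this
  rw [abs_mul, abs_of_pos (inv_pos.2 hε), inv_mul_le_iff₀ hε]
  linarith

/-- Lipschitz functions are uniform limits of twice continuously differentiable ones. -/
theorem exists_smooth_approx (hL : LipschitzWith 1 h) {ε : ℝ} (hε : 0 < ε) :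
    ∃ h' k l : ℝ → ℝ, ∃ C, (∀ x, HasDerivAt h' (k x) x) ∧ (∀ x, HasDerivAt k (l x) x) ∧
      Continuous l ∧ (∀ x, |k x| ≤ 1) ∧ (∀ x, |l x| ≤ C) ∧ ∀ x, |h' x - h x| ≤ 2 * ε := by
  have hc := hL.continuous
  have hL' : ∀ x y, |h x - h y| ≤ |x - y| := fun x y => by
    simpa [Real.dist_eq] using hL.dist_le_mul x y
  have hd := hasDerivAt_movAvg hc ε
  have hb := abs_movAvg_deriv_le hε hL'
  have hL1 := abs_sub_le_of_deriv hd hb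
  have hc1 : Continuous (movAvg ε h) :=
    continuous_iff_continuousAt.2 fun x => (hd x).continuousAt
  -- Each averaging gains one derivative, keeps the Lipschitz constant 1 and costs ε in the uniform
  -- norm.
  refine ⟨movAvg ε (movAvg ε h), _, _, ε⁻¹ * (1 + 1), hasDerivAt_movAvg hc1 ε,
    fun x => (((hd (x + ε)).comp_add_const x ε).sub (hd x)).const_mul _, by fun_prop,
    abs_movAvg_deriv_le hε hL1, fun x => ?_, fun x => ?_⟩
  · rw [abs_mul, abs_of_pos (inv_pos.2 hε)]
    exact mul_le_mul_of_nonneg_left ((abs_sub _ _).trans (add_le_add (hb _) (hb _)))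
      (inv_pos.2 hε).le
  · have h1 := abs_movAvg_sub_le hc1 hε hL1 x
    have h2 := abs_movAvg_sub_le hc hε hL' x
    have h3 := abs_add_le (movAvg ε (movAvg ε h) x - movAvg ε h x) (movAvg ε h x - h x)
    rw [sub_add_sub_cancel] at h3
    linarith

end

end StdGaussian

/-! ### Random series with summable L¹ norms. -/

namespace ProductMalliavin

section Series

variable {Ω : Type*} {m0 : MeasurableSpace Ω} {P : Measure Ω}

lemma lintegral_enorm_sq (f : Ω → ℝ) : ∫⁻ ω, ‖f ω‖ₑ ^ 2 ∂P = eLpNorm f 2 P ^ 2 := by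
  have := eLpNorm_nnreal_pow_eq_lintegral (f := f) (μ := P) (p := 2) two_ne_zero
  simp only [NNReal.coe_ofNat, ENNReal.coe_ofNat] at this
  rw [← ENNReal.rpow_natCast]
  simp only [Nat.cast_ofNat, this]
  refine lintegral_congr fun ω => ?_
  rw [← ENNReal.rpow_natCast]
  simp

lemma lintegral_enorm_sq_eq_ofReal {f : Ω → ℝ} (hf : MemLp f 2 P) :
    ∫⁻ ω, ‖f ω‖ₑ ^ 2 ∂P = ENNReal.ofReal (∫ ω, f ω ^ 2 ∂P) := by
  rw [ofReal_integral_eq_lintegral_ofReal hf.integrable_sq (ae_of_all _ fun ω => sq_nonneg _)]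
  refine lintegral_congr fun ω => ?_
  rw [← enorm_pow, Real.enorm_eq_ofReal (sq_nonneg _)]

/-- The crude ab ≤ max(a, b)² ≤ a² + b² suffices, since only finiteness is needed. -/
lemma lintegral_enorm_mul_le {f g : Ω → ℝ} (hf : AEStronglyMeasurable f P) :
    ∫⁻ ω, ‖f ω * g ω‖ₑ ∂P ≤ ∫⁻ ω, ‖f ω‖ₑ ^ 2 ∂P + ∫⁻ ω, ‖g ω‖ₑ ^ 2 ∂P := by
  rw [← lintegral_add_left' (hf.enorm.pow_const 2)]
  refine lintegral_mono fun ω => ?_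
  rw [enorm_mul]
  rcases le_total ‖f ω‖ₑ ‖g ω‖ₑ with h | h
  · refine le_trans ?_ le_add_self
    rw [sq]
    gcongr
  · refine le_trans ?_ le_self_add
    rw [sq]
    gcongr

lemma tsum_lintegral_enorm_mul_ne_top {f g : ℕ → Ω → ℝ}
    (hf : ∀ k, AEStronglyMeasurable (f k) P) (h1 : ∑' k, ∫⁻ ω, ‖f k ω‖ₑ ^ 2 ∂P ≠ ∞)
    (h2 : ∑' k, ∫⁻ ω, ‖g k ω‖ₑ ^ 2 ∂P ≠ ∞) : ∑' k, ∫⁻ ω, ‖f k ω * g k ω‖ₑ ∂P ≠ ∞ := by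
  refine ne_top_of_le_ne_top (ENNReal.add_ne_top.2 ⟨h1, h2⟩) ?_
  rw [← ENNReal.tsum_add]
  exact ENNReal.tsum_le_tsum fun k => lintegral_enorm_mul_le (hf k)

variable {v : ℕ → Ω → ℝ}

lemma ae_summable_of_tsum_lintegral (hv : ∀ k, AEStronglyMeasurable (v k) P)
    (h : ∑' k, ∫⁻ ω, ‖v k ω‖ₑ ∂P ≠ ∞) : ∀ᵐ ω ∂P, Summable fun k => v k ω := by
  rw [← lintegral_tsum fun k => (hv k).enorm] at h
  filter_upwards [ae_lt_top' (AEMeasurable.tsum fun k => (hv k).enorm) h]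
    with ω hω
  refine Summable.of_norm ?_
  simpa using ENNReal.summable_toReal hω.ne

lemma integrable_of_tsum_lintegral (hv : ∀ k, AEStronglyMeasurable (v k) P)
    (h : ∑' k, ∫⁻ ω, ‖v k ω‖ₑ ∂P ≠ ∞) (k : ℕ) : Integrable (v k) P :=
  ⟨hv k, (ne_top_of_le_ne_top h (ENNReal.le_tsum k)).lt_top⟩

lemma integrable_tsum_of_tsum_lintegral (hv : ∀ k, AEStronglyMeasurable (v k) P)
    (h : ∑' k, ∫⁻ ω, ‖v k ω‖ₑ ∂P ≠ ∞) : Integrable (fun ω => ∑' k, v k ω) P := by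
  refine ⟨?_, ?_⟩
  · refine aestronglyMeasurable_of_tendsto_ae atTop
      (f := fun n ω => ∑ k ∈ Finset.range n, v k ω) (fun n => ?_) ?_
    · exact Finset.aestronglyMeasurable_fun_sum _ fun k _ => hv k
    · filter_upwards [ae_summable_of_tsum_lintegral hv h] with ω hω
      exact hω.hasSum.tendsto_sum_nat
  · refine lt_of_le_of_lt ?_ h.lt_top
    rw [← lintegral_tsum fun k => (hv k).enorm]
    exact lintegral_mono fun ω => enorm_tsum_le_tsum_enorm

lemma hasSum_integral_of_tsum_lintegral (hv : ∀ k, AEStronglyMeasurable (v k) P)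
    (h : ∑' k, ∫⁻ ω, ‖v k ω‖ₑ ∂P ≠ ∞) :
    HasSum (fun k => ∫ ω, v k ω ∂P) (∫ ω, ∑' k, v k ω ∂P) := by
  refine hasSum_integral_of_summable_integral_norm (integrable_of_tsum_lintegral hv h) ?_
  simpa only [integral_norm_eq_lintegral_enorm (hv _)] using ENNReal.summable_toReal h

lemma integral_sq_condExp_le {m : MeasurableSpace Ω} {F : Ω → ℝ} (hF : MemLp F 2 P) :
    ∫ ω, (P[F | m]) ω ^ 2 ∂P ≤ ∫ ω, F ω ^ 2 ∂P := by
  have h := pow_le_pow_left₀ zero_le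
    (eLpNorm_condExp_le_eLpNorm (m := m) (μ := P) F one_le_two) 2
  rw [← lintegral_enorm_sq, ← lintegral_enorm_sq, lintegral_enorm_sq_eq_ofReal hF,
    lintegral_enorm_sq_eq_ofReal (hF.condExp one_le_two)] at h
  exact (ENNReal.ofReal_le_ofReal_iff (integral_nonneg fun ω => sq_nonneg _)).1 h

end Series

/-! ### Conditional expectation and independence. -/

section CondExp

variable {Ω : Type*} {m0 : MeasurableSpace Ω} {P : Measure Ω} [IsProbabilityMeasure P]

lemma isPiSystem_image2_inter (m₁ m₂ : MeasurableSpace Ω) :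
    IsPiSystem (Set.image2 (· ∩ ·) {A | MeasurableSet[m₁] A} {B | MeasurableSet[m₂] B}) := by
  rintro _ ⟨A, hA, B, hB, rfl⟩ _ ⟨A', hA', B', hB', rfl⟩ _
  refine ⟨A ∩ A', MeasurableSet.inter hA hA', B ∩ B', MeasurableSet.inter hB hB', ?_⟩
  exact (Set.inter_inter_inter_comm A B A' B').symm

lemma sup_eq_generateFrom_image2_inter (m₁ m₂ : MeasurableSpace Ω) :
    m₁ ⊔ m₂ = MeasurableSpace.generateFrom
      (Set.image2 (· ∩ ·) {A | MeasurableSet[m₁] A} {B | MeasurableSet[m₂] B}) := by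
  refine le_antisymm (sup_le (fun A hA => ?_) fun B hB => ?_)
    (MeasurableSpace.generateFrom_le ?_)
  · exact MeasurableSpace.measurableSet_generateFrom
      ⟨A, hA, Set.univ, MeasurableSet.univ, Set.inter_univ A⟩
  · exact MeasurableSpace.measurableSet_generateFrom
      ⟨Set.univ, MeasurableSet.univ, B, hB, Set.univ_inter B⟩
  · rintro _ ⟨A, hA, B, hB, rfl⟩
    exact MeasurableSet.inter ((le_sup_left : m₁ ≤ m₁ ⊔ m₂) A hA)
      ((le_sup_right : m₂ ≤ m₁ ⊔ m₂) B hB)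

/-- By independence the conditional expectation of 1_A Y given m₂ is constant; integrate it over B.
-/
lemma setIntegral_inter_of_indep {m₁ m₂ : MeasurableSpace Ω} (h₁ : m₁ ≤ m0) (h₂ : m₂ ≤ m0)
    (hind : Indep m₁ m₂ P) {Y : Ω → ℝ} (hY : StronglyMeasurable[m₁] Y) (hYi : Integrable Y P)
    {A B : Set Ω} (hA : MeasurableSet[m₁] A) (hB : MeasurableSet[m₂] B) :
    ∫ ω in A ∩ B, Y ω ∂P = P.real B * ∫ ω in A, Y ω ∂P := by
  have h3 := setIntegral_condExp h₂ (hYi.indicator (h₁ A hA)) hB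
  rw [setIntegral_indicator (h₁ A hA)] at h3
  rw [Set.inter_comm, ← h3, setIntegral_congr_ae (g := fun _ => ∫ ω in A, Y ω ∂P) (h₂ B hB)]
  · rw [setIntegral_const, smul_eq_mul]
  · filter_upwards [condExp_indep_eq h₁ h₂ (hY.indicator hA) hind] with ω hω _
    rw [hω, integral_indicator (h₁ A hA)]

/-- Conditioning additionally on independent information does not change a conditional
expectation. -/
lemma condExp_sup_of_indep {m₁ m₁' m₂ : MeasurableSpace Ω} (h11 : m₁ ≤ m₁') (h₁ : m₁' ≤ m0)
    (h₂ : m₂ ≤ m0) (hind : Indep m₁' m₂ P) {Y : Ω → ℝ} (hY : StronglyMeasurable[m₁'] Y)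
    (hYi : Integrable Y P) : P[Y | m₁ ⊔ m₂] =ᵐ[P] P[Y | m₁] := by
  have hle : m₁ ⊔ m₂ ≤ m0 := sup_le (h11.trans h₁) h₂
  have hsm : StronglyMeasurable[m₁] (P[Y | m₁]) := stronglyMeasurable_condExp
  refine (ae_eq_condExp_of_forall_setIntegral_eq hle hYi (fun _ _ _ =>
    integrable_condExp.integrableOn) (fun s hs _ => ?_)
    (hsm.mono (le_sup_left : m₁ ≤ m₁ ⊔ m₂)).aestronglyMeasurable).symm
  have hci : Integrable (P[Y | m₁]) P := integrable_condExp
  -- The sets A ∩ B form a π-system generating `m₁ ⊔ m₂`. On them both integrals factor through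
  -- P(B), leaving the defining property on A.
  induction s, hs using MeasurableSpace.induction_on_inter
    (sup_eq_generateFrom_image2_inter m₁ m₂) (isPiSystem_image2_inter m₁ m₂) with
  | empty => simp
  | basic t ht =>
    obtain ⟨A, hA, B, hB, rfl⟩ := ht
    rw [setIntegral_inter_of_indep h₁ h₂ hind (hsm.mono h11) hci (h11 A hA) hB,
      setIntegral_inter_of_indep h₁ h₂ hind hY hYi (h11 A hA) hB,
      setIntegral_condExp (h11.trans h₁) hYi hA]
  | compl t ht iht =>
    have iht := iht (measure_lt_top _ _)
    have e1 := integral_add_compl (hle t ht) hci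
    have e2 := integral_add_compl (hle t ht) hYi
    rw [integral_condExp (h11.trans h₁)] at e1
    linarith
  | iUnion f hd hf ih =>
    rw [integral_iUnion (fun i => hle _ (hf i)) hd hci.integrableOn,
      integral_iUnion (fun i => hle _ (hf i)) hd hYi.integrableOn]
    exact tsum_congr fun i => ih i (measure_lt_top _ _)

/-- W can be pulled out of the conditional expectation. This orthogonality is the integration by
parts behind the whole argument. -/
lemma integral_sub_condExp_mul {m : MeasurableSpace Ω} (hm : m ≤ m0) {Y W : Ω → ℝ}
    (hY : Integrable Y P) (hW : StronglyMeasurable[m] W) (hYW : Integrable (Y * W) P) :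
    ∫ ω, (Y ω - (P[Y | m]) ω) * W ω ∂P = 0 := by
  have h1 := condExp_mul_of_stronglyMeasurable_right hW hYW hY
  have h2 : Integrable (P[Y | m] * W) P := integrable_condExp.congr h1
  have h3 : ∫ ω, (P[Y | m] * W) ω ∂P = ∫ ω, (Y * W) ω ∂P := by
    rw [← integral_condExp hm (f := Y * W)]
    exact integral_congr_ae h1.symm
  have h4 : (fun ω => (Y ω - (P[Y | m]) ω) * W ω) = Y * W - P[Y | m] * W := by
    ext ω
    simp [sub_mul]
  rw [h4]
  rw [integral_sub' hYW h2, h3, sub_self]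

end CondExp

/-! ### The operators D_k and the martingale increments. -/

section SigmaOf

variable {Ω : Type*} {E : ℕ → Type*} [∀ n, MeasurableSpace (E n)] {X : ∀ n, Ω → E n}

lemma sigmaOf_mono {M N : Set ℕ} (h : M ⊆ N) : sigmaOf X M ≤ sigmaOf X N :=
  biSup_mono h

lemma sigmaOf_union (M N : Set ℕ) : sigmaOf X (M ∪ N) = sigmaOf X M ⊔ sigmaOf X N :=
  iSup_union

lemma sigmaOf_empty : sigmaOf X ∅ = ⊥ := by simp [sigmaOf]

end SigmaOf

section Product

variable {Ω : Type*} [MeasurableSpace Ω] {P : Measure Ω}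
  {E : ℕ → Type*} [∀ n, MeasurableSpace (E n)] {X : ∀ n, Ω → E n}

lemma sigmaOf_le (hX : ∀ n, Measurable (X n)) (M : Set ℕ) :
    sigmaOf X M ≤ (inferInstance : MeasurableSpace Ω) :=
  iSup₂_le fun j _ => (hX j).comap_le

lemma indep_sigmaOf (hX : ∀ n, Measurable (X n)) (hindep : iIndepFun X P) {M N : Set ℕ}
    (h : Disjoint M N) : Indep (sigmaOf X M) (sigmaOf X N) P :=
  indep_iSup_of_disjoint (fun n => (hX n).comap_le) hindep.iIndep h

lemma memLp_D (k : ℕ) {Y : Ω → ℝ} (hY : MemLp Y 2 P) : MemLp (D P X k Y) 2 P :=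
  hY.sub (hY.condExp one_le_two)

lemma D_sub_ae_eq (k : ℕ) {F G : Ω → ℝ} (hF : Integrable F P) (hG : Integrable G P) :
    D P X k (F - G) =ᵐ[P] D P X k F - D P X k G := by
  filter_upwards [condExp_sub hF hG (sigmaOf X {k}ᶜ)] with ω hω
  simp only [D, hω, Pi.sub_apply]
  ring

lemma eLpNorm_D_le (k : ℕ) {F : Ω → ℝ} (hF : AEStronglyMeasurable F P)
    (hX : ∀ n, Measurable (X n)) : eLpNorm (D P X k F) 2 P ≤ 2 * eLpNorm F 2 P := by
  have h1 : AEStronglyMeasurable (P[F | sigmaOf X {k}ᶜ]) P :=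
    (stronglyMeasurable_condExp.mono (sigmaOf_le hX _)).aestronglyMeasurable
  refine (eLpNorm_sub_le hF h1 one_le_two).trans ?_
  rw [two_mul]
  gcongr
  exact eLpNorm_condExp_le_eLpNorm F one_le_two

lemma memLp_clarkOcone {F : Ω → ℝ} (hF : MemLp F 2 P) (k : ℕ) : MemLp (clarkOcone P X F k) 2 P :=
  memLp_D k (hF.condExp one_le_two)

variable [IsProbabilityMeasure P]

/-- Integrating out the last coordinate of a function of `X_0, …, X_k`. -/
lemma condExp_compl_singleton (hX : ∀ n, Measurable (X n)) (hindep : iIndepFun X P) (k : ℕ)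
    {Y : Ω → ℝ} (hY : StronglyMeasurable[sigmaOf X (Set.Iic k)] Y) (hYi : Integrable Y P) :
    P[Y | sigmaOf X {k}ᶜ] =ᵐ[P] P[Y | sigmaOf X (Set.Iio k)] := by
  have h1 : ({k}ᶜ : Set ℕ) = Set.Iio k ∪ Set.Ioi k := Set.Iio_union_Ioi.symm
  rw [h1, sigmaOf_union]
  refine condExp_sup_of_indep (sigmaOf_mono Set.Iio_subset_Iic_self) (sigmaOf_le hX _)
    (sigmaOf_le hX _) (indep_sigmaOf hX hindep ?_) hY hYi
  exact Set.disjoint_left.2 fun a ha hb => absurd (Set.mem_Iic.1 ha) (not_le.2 hb)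

/-- Conditioning an F_k-measurable variable on G_k amounts, by independence, to conditioning on the
coordinates before k. Writing the fields with `Set.Iio` makes sums over k telescope down to the
trivial field at 0. -/
lemma clarkOcone_ae_eq (hX : ∀ n, Measurable (X n)) (hindep : iIndepFun X P) (F : Ω → ℝ) (k : ℕ) :
    clarkOcone P X F k =ᵐ[P]
      P[F | sigmaOf X (Set.Iio (k + 1))] - P[F | sigmaOf X (Set.Iio k)] := by
  have h1 := condExp_compl_singleton (P := P) hX hindep k
    (stronglyMeasurable_condExp (f := F) (m := sigmaOf X (Set.Iic k)) (μ := P)) integrable_condExp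
  have h2 : P[P[F | sigmaOf X (Set.Iic k)] | sigmaOf X (Set.Iio k)] =ᵐ[P]
      P[F | sigmaOf X (Set.Iio k)] :=
    condExp_condExp_of_le (sigmaOf_mono Set.Iio_subset_Iic_self) (sigmaOf_le hX _)
  have h3 : Set.Iio (k + 1) = Set.Iic k := by
    ext j
    simp
  filter_upwards [h1, h2] with ω hω1 hω2
  simp only [clarkOcone, D, Pi.sub_apply, h3, hω1, hω2]

lemma integral_D_mul (hX : ∀ n, Measurable (X n)) (k : ℕ) {Y W : Ω → ℝ} (hY : Integrable Y P)
    (hW : StronglyMeasurable[sigmaOf X {k}ᶜ] W) (hYW : Integrable (Y * W) P) :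
    ∫ ω, D P X k Y ω * W ω ∂P = 0 :=
  integral_sub_condExp_mul (sigmaOf_le hX _) hY hW hYW

/-- Pythagoras: a martingale increment Y - Z is orthogonal to the earlier value Z. -/
lemma integral_sq_clarkOcone (hX : ∀ n, Measurable (X n)) (hindep : iIndepFun X P) {F : Ω → ℝ}
    (hF : MemLp F 2 P) (k : ℕ) :
    ∫ ω, clarkOcone P X F k ω ^ 2 ∂P =
      ∫ ω, (P[F | sigmaOf X (Set.Iio (k + 1))]) ω ^ 2 ∂P
        - ∫ ω, (P[F | sigmaOf X (Set.Iio k)]) ω ^ 2 ∂P := by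
  set Y := P[F | sigmaOf X (Set.Iio (k + 1))]
  set Z := P[F | sigmaOf X (Set.Iio k)] with hZ
  have hY2 : MemLp Y 2 P := hF.condExp one_le_two
  have hZ2 : MemLp Z 2 P := hF.condExp one_le_two
  have h2 : P[Y | sigmaOf X (Set.Iio k)] =ᵐ[P] Z :=
    condExp_condExp_of_le (sigmaOf_mono (Set.Iio_subset_Iio k.le_succ)) (sigmaOf_le hX _)
  have h1 : ∫ ω, (Y ω - Z ω) * Z ω ∂P = 0 := by
    rw [← integral_sub_condExp_mul (sigmaOf_le hX (Set.Iio k)) (hY2.integrable one_le_two)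
      (W := Z) stronglyMeasurable_condExp (hY2.integrable_mul hZ2)]
    refine integral_congr_ae ?_
    filter_upwards [h2] with ω hω
    rw [hω]
  have h3 : ∫ ω, clarkOcone P X F k ω ^ 2 ∂P
      = ∫ ω, (Y ω ^ 2 - Z ω ^ 2 - 2 * ((Y ω - Z ω) * Z ω)) ∂P := by
    refine integral_congr_ae ?_
    filter_upwards [clarkOcone_ae_eq hX hindep F k] with ω hω
    rw [hω, Pi.sub_apply]
    ring
  have hi : Integrable (fun ω => (Y ω - Z ω) * Z ω) P := (hY2.sub hZ2).integrable_mul hZ2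
  rw [h3, integral_sub (f := fun ω => Y ω ^ 2 - Z ω ^ 2) (hY2.integrable_sq.sub hZ2.integrable_sq)
      (hi.const_mul 2),
    integral_const_mul, h1, integral_sub hY2.integrable_sq hZ2.integrable_sq]
  ring

lemma tsum_clarkOcone_ne_top (hX : ∀ n, Measurable (X n)) (hindep : iIndepFun X P) {F : Ω → ℝ}
    (hF : MemLp F 2 P) : ∑' k, ∫⁻ ω, ‖clarkOcone P X F k ω‖ₑ ^ 2 ∂P ≠ ∞ := by
  simp only [fun k => lintegral_enorm_sq_eq_ofReal (memLp_clarkOcone (X := X) hF k)]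
  have hs : Summable fun k => ∫ ω, clarkOcone P X F k ω ^ 2 ∂P := by
    refine summable_of_sum_range_le (c := ∫ ω, F ω ^ 2 ∂P)
      (fun k => integral_nonneg fun ω => sq_nonneg _) fun n => ?_
    simp only [integral_sq_clarkOcone hX hindep hF]
    rw [Finset.sum_range_sub fun k => ∫ ω, (P[F | sigmaOf X (Set.Iio k)]) ω ^ 2 ∂P]
    have h1 := integral_sq_condExp_le (m := sigmaOf X (Set.Iio n)) hF
    have h2 : 0 ≤ ∫ ω, (P[F | sigmaOf X (Set.Iio 0)]) ω ^ 2 ∂P :=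
      integral_nonneg fun ω => sq_nonneg _
    linarith
  rw [← ENNReal.ofReal_tsum_of_nonneg (fun k => integral_nonneg fun ω => sq_nonneg _) hs]
  exact ENNReal.ofReal_ne_top

/-- For elements of its domain, the derivative is given by `D`, and is square-integrable. -/
lemma tsum_D_ne_top (hX : ∀ n, Measurable (X n)) {F : Ω → ℝ} (hF : MemDomD P X F) :
    ∑' k, ∫⁻ ω, ‖D P X k F ω‖ₑ ^ 2 ∂P ≠ ∞ := by
  obtain ⟨⟨-, hF2⟩, G, U, hG, hU, hUn, hGF, hDU⟩ := hF
  have hG2 : ∀ n, MemLp (G n) 2 P := fun n => (hG n).choose_spec.2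
  have hU' : ∀ k, AEStronglyMeasurable (U k) P := fun k => (hU k).mono (sigmaOf_le hX _)
  -- D_k is bounded on L² with norm at most 2, so D_k G_n converges both to D_k F and to U_k.
  have key : ∀ k, D P X k F =ᵐ[P] U k := by
    intro k
    have h1 : ∀ n, eLpNorm (D P X k F - U k) 2 P ≤ 2 * eLpNorm (fun ω => G n ω - F ω) 2 P +
        (processNormSq P fun k ω => D P X k (G n) ω - U k ω) ^ (1 / 2 : ℝ) := by
      intro n
      have e1 : eLpNorm (D P X k F - D P X k (G n)) 2 P
          ≤ 2 * eLpNorm (fun ω => G n ω - F ω) 2 P := by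
        rw [← eLpNorm_congr_ae (D_sub_ae_eq k (hF2.integrable one_le_two)
          ((hG2 n).integrable one_le_two)), show (fun ω => G n ω - F ω) = G n - F from rfl,
          eLpNorm_sub_comm]
        exact eLpNorm_D_le k (hF2.sub (hG2 n)).1 hX
      have e2 : eLpNorm (D P X k (G n) - U k) 2 P
          ≤ (processNormSq P fun k ω => D P X k (G n) ω - U k ω) ^ (1 / 2 : ℝ) := by
        have hle : eLpNorm (D P X k (G n) - U k) 2 P ^ 2
            ≤ processNormSq P fun k ω => D P X k (G n) ω - U k ω := by
          rw [← lintegral_enorm_sq]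
          exact ENNReal.le_tsum (f := fun k => ∫⁻ ω, ‖D P X k (G n) ω - U k ω‖ₑ ^ 2 ∂P) k
        have := ENNReal.rpow_le_rpow hle (show (0 : ℝ) ≤ 1 / 2 by norm_num)
        rw [← ENNReal.rpow_natCast, ← ENNReal.rpow_mul] at this
        simpa using this
      have e3 : D P X k F - U k = (D P X k F - D P X k (G n)) + (D P X k (G n) - U k) := by
        abel
      rw [e3]
      exact (eLpNorm_add_le ((memLp_D k hF2).sub (memLp_D k (hG2 n))).1
        ((memLp_D k (hG2 n)).1.sub (hU' k)) one_le_two).trans (add_le_add e1 e2)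
    have h2 : Tendsto (fun n => 2 * eLpNorm (fun ω => G n ω - F ω) 2 P +
        (processNormSq P fun k ω => D P X k (G n) ω - U k ω) ^ (1 / 2 : ℝ)) atTop (𝓝 0) := by
      have e1 := ENNReal.Tendsto.const_mul (a := 2) hGF (Or.inr (by simp))
      have e2 := (ENNReal.continuous_rpow_const (y := 1 / 2)).tendsto 0 |>.comp hDU
      have := e1.add e2
      simpa using this
    have h3 : eLpNorm (D P X k F - U k) 2 P = 0 :=
      le_antisymm (ge_of_tendsto' h2 h1) (zero_le)
    have h4 := (eLpNorm_eq_zero_iff ((memLp_D k hF2).1.sub (hU' k)) two_ne_zero).1 h3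
    filter_upwards [h4] with ω hω
    simpa [sub_eq_zero] using hω
  refine ne_top_of_le_ne_top hUn.ne (le_of_eq ?_)
  refine tsum_congr fun k => lintegral_congr_ae ?_
  filter_upwards [key k] with ω hω
  rw [hω]

/-- Lévy's upward theorem tested against a bounded function. -/
lemma tendsto_sum_clarkOcone (hX : ∀ n, Measurable (X n)) (hindep : iIndepFun X P) {F : Ω → ℝ}
    (hF : MemL2 P X Set.univ F) (hF0 : ∫ ω, F ω ∂P = 0) {W : Ω → ℝ}
    (hW : AEStronglyMeasurable W P) {C : ℝ} (hC : ∀ ω, |W ω| ≤ C) :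
    Tendsto (fun n => ∑ k ∈ Finset.range n, ∫ ω, clarkOcone P X F k ω * W ω ∂P) atTop
      (𝓝 (∫ ω, F ω * W ω ∂P)) := by
  let ℱ : Filtration ℕ (inferInstance : MeasurableSpace Ω) :=
    ⟨fun n => sigmaOf X (Set.Iio n), fun i j hij => sigmaOf_mono (Set.Iio_subset_Iio hij),
      fun n => sigmaOf_le hX _⟩
  have hFi : Integrable F P := hF.2.integrable one_le_two
  have hsup : ⨆ n, ℱ n = sigmaOf X Set.univ := by
    refine le_antisymm (iSup_le fun n => sigmaOf_mono (Set.subset_univ _))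
      (iSup₂_le fun j _ => ?_)
    refine le_trans ?_ (le_iSup (fun n => (ℱ n : MeasurableSpace Ω)) (j + 1))
    exact le_iSup₂_of_le (f := fun i (_ : i ∈ Set.Iio (j + 1)) =>
      MeasurableSpace.comap (X i) inferInstance) j (Set.mem_Iio.2 j.lt_succ_self) le_rfl
  have hlim := tendsto_eLpNorm_condExp (ℱ := ℱ) (μ := P) F
  rw [hsup] at hlim
  have hFF : P[F | sigmaOf X Set.univ] =ᵐ[P] F :=
    condExp_of_aestronglyMeasurable' (sigmaOf_le hX _) hF.1 hFi
  have hi : ∀ n, Integrable (fun ω => (P[F | ℱ n]) ω * W ω) P := fun n =>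
    integrable_condExp.mul_bdd (c := C) hW (ae_of_all _ hC)
  -- L¹ convergence of the martingale is enough because W is bounded.
  have h1 : Tendsto (fun n => ∫ ω, (P[F | ℱ n]) ω * W ω ∂P) atTop (𝓝 (∫ ω, F ω * W ω ∂P)) := by
    refine tendsto_integral_of_L1' _ (hFi.1.mul hW) (Eventually.of_forall hi) ?_
    have hb : ∀ n, eLpNorm ((fun ω => (P[F | ℱ n]) ω * W ω) - fun ω => F ω * W ω) 1 P
        ≤ ENNReal.ofReal C * eLpNorm (P[F | ℱ n] - P[F | sigmaOf X Set.univ]) 1 P := by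
      intro n
      refine eLpNorm_le_mul_eLpNorm_of_ae_le_mul ?_ 1
      filter_upwards [hFF] with ω hω
      simp only [Pi.sub_apply, hω, ← sub_mul, norm_mul]
      rw [mul_comm]
      exact mul_le_mul_of_nonneg_right (hC ω) (norm_nonneg _)
    refine tendsto_of_tendsto_of_tendsto_of_le_of_le tendsto_const_nhds ?_ (fun _ => zero_le) hb
    simpa using ENNReal.Tendsto.const_mul (a := ENNReal.ofReal C) hlim (Or.inr (by simp))
  refine h1.congr fun n => ?_
  have h2 : ∀ k, ∫ ω, clarkOcone P X F k ω * W ω ∂P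
      = ∫ ω, (P[F | ℱ (k + 1)]) ω * W ω ∂P - ∫ ω, (P[F | ℱ k]) ω * W ω ∂P := by
    intro k
    rw [← integral_sub (hi _) (hi _)]
    refine integral_congr_ae ?_
    filter_upwards [clarkOcone_ae_eq hX hindep F k] with ω hω
    rw [hω, Pi.sub_apply, sub_mul]
  -- The field at 0 involves no coordinate, so the telescoping sum starts at E[F] = 0.
  have h3 : ∀ ω, (P[F | ℱ 0]) ω = 0 := by
    intro ω
    have : (ℱ 0 : MeasurableSpace Ω) = ⊥ := by
      show sigmaOf X (Set.Iio 0) = ⊥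
      rw [show Set.Iio (0 : ℕ) = ∅ by ext; simp, sigmaOf_empty]
    rw [this, condExp_bot, hF0]
  simp only [h2]
  rw [Finset.sum_range_sub fun k => ∫ ω, (P[F | ℱ k]) ω * W ω ∂P]
  simp [h3]

end Product

end ProductMalliavin

/-! ### The Malliavin-Stein bound and the Kolmogorov remainder. -/

namespace ProductMalliavin

section SteinBound

variable {Ω : Type*} [MeasurableSpace Ω] {P : Measure Ω}

lemma tsum_lintegral_mul_bdd_ne_top {v : ℕ → Ω → ℝ} (h : ∑' k, ∫⁻ ω, ‖v k ω‖ₑ ∂P ≠ ∞)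
    {w : Ω → ℝ} {C : ℝ} (hC : ∀ ω, |w ω| ≤ C) : ∑' k, ∫⁻ ω, ‖v k ω * w ω‖ₑ ∂P ≠ ∞ := by
  refine ne_top_of_le_ne_top (ENNReal.mul_ne_top h (ENNReal.ofReal_ne_top (r := C))) ?_
  rw [← ENNReal.tsum_mul_right]
  refine ENNReal.tsum_le_tsum fun k => ?_
  rw [← lintegral_mul_const' _ _ ENNReal.ofReal_ne_top]
  refine lintegral_mono fun ω => ?_
  rw [enorm_mul, Real.enorm_eq_ofReal_abs (w ω)]
  gcongr
  exact hC ω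

lemma hasSum_integral_mul_bdd {v : ℕ → Ω → ℝ} (hv : ∀ k, AEStronglyMeasurable (v k) P)
    (h : ∑' k, ∫⁻ ω, ‖v k ω‖ₑ ∂P ≠ ∞) {w : Ω → ℝ} (hw : AEStronglyMeasurable w P) {C : ℝ}
    (hC : ∀ ω, |w ω| ≤ C) :
    HasSum (fun k => ∫ ω, v k ω * w ω ∂P) (∫ ω, (∑' k, v k ω) * w ω ∂P) := by
  simpa only [tsum_mul_right] using hasSum_integral_of_tsum_lintegral (v := fun k ω => v k ω * w ω)
    (fun k => (hv k).mul hw) (tsum_lintegral_mul_bdd_ne_top h hC)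

lemma enorm_integral_mul_bdd_le {w y : Ω → ℝ} {C : ℝ} (hC : ∀ ω, |w ω| ≤ C) :
    ‖∫ ω, y ω * w ω ∂P‖ₑ ≤ ENNReal.ofReal C * ∫⁻ ω, ‖y ω‖ₑ ∂P := by
  refine (enorm_integral_le_lintegral_enorm _).trans ?_
  rw [← lintegral_const_mul' _ _ ENNReal.ofReal_ne_top]
  refine lintegral_mono fun ω => ?_
  rw [enorm_mul, mul_comm, Real.enorm_eq_ofReal_abs (w ω)]
  gcongr
  exact hC ω

variable {E : ℕ → Type*} [∀ n, MeasurableSpace (E n)] {X : ∀ n, Ω → E n} {F : Ω → ℝ}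

lemma memLp_condExp_abs_clarkOcone (hF : MemLp F 2 P) (k : ℕ) :
    MemLp (P[fun ω' => |clarkOcone P X F k ω'| | sigmaOf X {k}ᶜ]) 2 P :=
  MemLp.condExp one_le_two (memLp_clarkOcone hF k).abs

lemma sub_D_eq (k : ℕ) (ω : Ω) : F ω - D P X k F ω = (P[F | sigmaOf X {k}ᶜ]) ω := by
  rw [D, sub_sub_cancel]

variable [IsProbabilityMeasure P]

lemma tsum_clarkOcone_mul_D_ne_top (hX : ∀ n, Measurable (X n)) (hindep : iIndepFun X P)
    (hF : MemDomD P X F) :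
    ∑' k, ∫⁻ ω, ‖clarkOcone P X F k ω * D P X k F ω‖ₑ ∂P ≠ ∞ :=
  tsum_lintegral_enorm_mul_ne_top (fun k => (memLp_clarkOcone hF.1.2 k).1)
    (tsum_clarkOcone_ne_top hX hindep hF.1.2) (tsum_D_ne_top hX hF)

/-- Conditional expectation contracts L², so the first factors inherit square-summability from the
c_k. -/
lemma tsum_condExp_mul_D_ne_top (hX : ∀ n, Measurable (X n)) (hindep : iIndepFun X P)
    (hF : MemDomD P X F) :
    ∑' k, ∫⁻ ω, ‖(P[fun ω' => |clarkOcone P X F k ω'| | sigmaOf X {k}ᶜ]) ω *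
      D P X k F ω‖ₑ ∂P ≠ ∞ := by
  refine tsum_lintegral_enorm_mul_ne_top
    (fun k => (memLp_condExp_abs_clarkOcone hF.1.2 k).1) ?_ (tsum_D_ne_top hX hF)
  refine ne_top_of_le_ne_top (tsum_clarkOcone_ne_top hX hindep hF.1.2)
    (ENNReal.tsum_le_tsum fun k => ?_)
  rw [lintegral_enorm_sq_eq_ofReal (memLp_condExp_abs_clarkOcone hF.1.2 k),
    lintegral_enorm_sq_eq_ofReal (memLp_clarkOcone hF.1.2 k)]
  refine ENNReal.ofReal_le_ofReal ?_
  refine (integral_sq_condExp_le (memLp_clarkOcone (X := X) hF.1.2 k).abs).trans_eq ?_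
  simp only [Pi.abs_apply, sq_abs]

/-- The Malliavin-Stein bound for a pair `f`, `u`, where `u` plays the role of `f'`. -/
lemma malliavin_stein_bound (hX : ∀ n, Measurable (X n)) (hindep : iIndepFun X P)
    (hF : MemDomD P X F) (hF0 : ∫ ω, F ω ∂P = 0) {f u : ℝ → ℝ} (hf : Continuous f)
    (hu : Measurable u) {A B : ℝ} (hfA : ∀ x, |f x| ≤ A) (huB : ∀ x, |u x| ≤ B) :
    ‖∫ ω, (u (F ω) - F ω * f (F ω)) ∂P‖ₑ ≤
      ENNReal.ofReal B * (∫⁻ ω, ‖1 - ∑' k, clarkOcone P X F k ω * D P X k F ω‖ₑ ∂P) +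
        ∑' k, ∫⁻ ω, ‖clarkOcone P X F k ω *
          (f (F ω) - f (F ω - D P X k F ω) - u (F ω) * D P X k F ω)‖ₑ ∂P := by
  have hF2 := hF.1.2
  have hFi : Integrable F P := hF2.integrable one_le_two
  have hc2 := memLp_clarkOcone (X := X) hF2
  have hci : ∀ k, Integrable (clarkOcone P X F k) P := fun k => (hc2 k).integrable one_le_two
  have hd2 := fun k => memLp_D (X := X) k hF2
  have hv : ∀ k, AEStronglyMeasurable (fun ω => clarkOcone P X F k ω * D P X k F ω) P :=
    fun k => (hc2 k).1.mul (hd2 k).1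
  have hsum := tsum_clarkOcone_mul_D_ne_top hX hindep hF
  have huF : AEStronglyMeasurable (fun ω => u (F ω)) P :=
    (hu.comp_aemeasurable hFi.1.aemeasurable).aestronglyMeasurable
  have hfF : AEStronglyMeasurable (fun ω => f (F ω)) P := hf.comp_aestronglyMeasurable hFi.1
  have hT := integrable_tsum_of_tsum_lintegral hv hsum
  have hTu : Integrable (fun ω => (∑' k, clarkOcone P X F k ω * D P X k F ω) * u (F ω)) P :=
    hT.mul_bdd (c := B) huF (ae_of_all _ fun ω => huB _)
  have hr : ∀ k, ∫ ω, clarkOcone P X F k ω *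
      (f (F ω) - f (F ω - D P X k F ω) - u (F ω) * D P X k F ω) ∂P
      = ∫ ω, clarkOcone P X F k ω * f (F ω) ∂P
        - ∫ ω, clarkOcone P X F k ω * D P X k F ω * u (F ω) ∂P := by
    intro k
    have hW : StronglyMeasurable[sigmaOf X {k}ᶜ] fun ω => f (F ω - D P X k F ω) := by
      simp only [sub_D_eq]
      exact hf.comp_stronglyMeasurable stronglyMeasurable_condExp
    have hWm := (hW.mono (sigmaOf_le hX _)).aestronglyMeasurable (μ := P)
    -- F - D_k F is the conditional expectation of F given G_k, hence f of it is orthogonal to the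
    -- range of D_k.
    have h0 : ∫ ω, clarkOcone P X F k ω * f (F ω - D P X k F ω) ∂P = 0 :=
      integral_D_mul hX k integrable_condExp hW
        (integrable_condExp.mul_bdd (c := A) hWm (ae_of_all _ fun ω => hfA _))
    have i1 : Integrable (fun ω => clarkOcone P X F k ω * f (F ω)) P :=
      (hci k).mul_bdd (c := A) hfF (ae_of_all _ fun ω => hfA _)
    have i2 : Integrable (fun ω => clarkOcone P X F k ω * f (F ω - D P X k F ω)) P :=
      (hci k).mul_bdd (c := A) hWm (ae_of_all _ fun ω => hfA _)
    have i3 : Integrable (fun ω => clarkOcone P X F k ω * D P X k F ω * u (F ω)) P :=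
      (integrable_of_tsum_lintegral hv hsum k).mul_bdd (c := B) huF (ae_of_all _ fun ω => huB _)
    have h1 : (fun ω => clarkOcone P X F k ω *
        (f (F ω) - f (F ω - D P X k F ω) - u (F ω) * D P X k F ω))
        = fun ω => clarkOcone P X F k ω * f (F ω) - clarkOcone P X F k ω * f (F ω - D P X k F ω)
          - clarkOcone P X F k ω * D P X k F ω * u (F ω) := by
      funext ω
      ring
    rw [h1, integral_sub (f := fun ω => clarkOcone P X F k ω * f (F ω)
      - clarkOcone P X F k ω * f (F ω - D P X k F ω)) (i1.sub i2) i3, integral_sub i1 i2, h0,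
      sub_zero]
  have hlim := (tendsto_sum_clarkOcone hX hindep hF.1 hF0 hfF fun ω => hfA (F ω)).sub
    (hasSum_integral_mul_bdd hv hsum huF fun ω => huB (F ω)).tendsto_sum_nat
  simp only [← Finset.sum_sub_distrib, ← hr] at hlim
  -- The remainder series may have infinite total mass. Each partial sum is dominated by that mass,
  -- and the bound passes to the limit of the partial sums.
  have hle := le_of_tendsto' ((continuous_enorm.tendsto _).comp hlim) fun n =>
    (enorm_sum_le (Finset.range n) _).trans ((Finset.sum_le_sum fun k _ =>
      enorm_integral_le_lintegral_enorm _).trans (ENNReal.sum_le_tsum (Finset.range n)))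
  have hFf : Integrable (fun ω => F ω * f (F ω)) P :=
    hFi.mul_bdd (c := A) hfF (ae_of_all _ fun ω => hfA _)
  have hui : Integrable (fun ω => u (F ω)) P :=
    Integrable.of_bound huF B (ae_of_all _ fun ω => huB _)
  have hdec : ∫ ω, (u (F ω) - F ω * f (F ω)) ∂P
      = ∫ ω, (1 - ∑' k, clarkOcone P X F k ω * D P X k F ω) * u (F ω) ∂P
        - (∫ ω, F ω * f (F ω) ∂P
          - ∫ ω, (∑' k, clarkOcone P X F k ω * D P X k F ω) * u (F ω) ∂P) := by
    simp only [sub_mul, one_mul]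
    rw [integral_sub hui hFf, integral_sub hui hTu]
    ring
  rw [hdec]
  exact enorm_sub_le.trans (add_le_add (enorm_integral_mul_bdd_le fun ω => huB _) hle)

/-- Split |c_k| = D_k|c_k| + e_k with e_k = E[|c_k| | G_k]. Since g increases, D_k F (g(F) - g(F -
D_k F)) ≥ 0, so the e_k parts need no absolute values: orthogonality deletes g(F - D_k F), and the
series over k is summed before an absolute value is taken. -/
lemma kolmogorov_remainder_le (hX : ∀ n, Measurable (X n)) (hindep : iIndepFun X P)
    (hF : MemDomD P X F) {g : ℝ → ℝ} (hg : Monotone g) (hg2 : ∀ x, |g x| ≤ 2)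
    (hgg : ∀ x y, |g x - g y| ≤ 2) :
    ∑' k, ∫⁻ ω, ‖clarkOcone P X F k ω *
        (D P X k F ω * (g (F ω) - g (F ω - D P X k F ω)))‖ₑ ∂P ≤
      2 * (∑' k, ∫⁻ ω, ‖D P X k (fun ω' => |clarkOcone P X F k ω'|) ω * D P X k F ω‖ₑ ∂P) +
        2 * ∫⁻ ω, ‖∑' k, (P[fun ω' => |clarkOcone P X F k ω'| | sigmaOf X {k}ᶜ]) ω *
          D P X k F ω‖ₑ ∂P := by
  have hF2 := hF.1.2
  have hFi : Integrable F P := hF2.integrable one_le_two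
  have hd2 := fun k => memLp_D (X := X) k hF2
  have he2 := memLp_condExp_abs_clarkOcone (X := X) hF2
  have hsum := tsum_condExp_mul_D_ne_top hX hindep hF
  set e : ℕ → Ω → ℝ := fun k => P[fun ω' => |clarkOcone P X F k ω'| | sigmaOf X {k}ᶜ] with he
  have hv : ∀ k, AEStronglyMeasurable (fun ω => e k ω * D P X k F ω) P :=
    fun k => (he2 k).1.mul (hd2 k).1
  have hgF : AEStronglyMeasurable (fun ω => g (F ω)) P :=
    (hg.measurable.comp_aemeasurable hFi.1.aemeasurable).aestronglyMeasurable
  have hρ : ∀ k ω, 0 ≤ D P X k F ω * (g (F ω) - g (F ω - D P X k F ω)) := by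
    intro k ω
    rcases le_total 0 (D P X k F ω) with h | h
    · exact mul_nonneg h (sub_nonneg.2 (hg (by linarith)))
    · exact mul_nonneg_of_nonpos_of_nonpos h (sub_nonpos.2 (hg (by linarith)))
  have hWs : ∀ k, StronglyMeasurable[sigmaOf X {k}ᶜ] fun ω => e k ω * g (F ω - D P X k F ω) := by
    intro k
    simp only [sub_D_eq]
    have h1 : StronglyMeasurable[sigmaOf X {k}ᶜ] (e k) := stronglyMeasurable_condExp
    have h2 : StronglyMeasurable[sigmaOf X {k}ᶜ] (P[F | sigmaOf X {k}ᶜ]) :=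
      stronglyMeasurable_condExp
    exact h1.mul (hg.measurable.comp h2.measurable).stronglyMeasurable
  have hgW : ∀ k, AEStronglyMeasurable (fun ω => g (F ω - D P X k F ω)) P := fun k =>
    (hg.measurable.comp_aemeasurable (hFi.1.sub (hd2 k).1).aemeasurable).aestronglyMeasurable
  have hi1 : ∀ k, Integrable (fun ω => e k ω * D P X k F ω * g (F ω)) P := fun k =>
    (integrable_of_tsum_lintegral hv hsum k).mul_bdd (c := 2) hgF (ae_of_all _ fun ω => hg2 _)
  have hi2 : ∀ k, Integrable (fun ω => D P X k F ω * (e k ω * g (F ω - D P X k F ω))) P := by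
    intro k
    refine ((integrable_of_tsum_lintegral hv hsum k).mul_bdd (c := 2) (hgW k)
      (ae_of_all _ fun ω => hg2 _)).congr (ae_of_all _ fun ω => ?_)
    simp only
    ring
  -- Here the orthogonality is that of D_k F itself, against a G_k-measurable product.
  have h0 : ∀ k, ∫ ω, D P X k F ω * (e k ω * g (F ω - D P X k F ω)) ∂P = 0 := by
    intro k
    refine integral_D_mul hX k hFi (hWs k) ?_
    refine (((hF2.integrable_mul (he2 k)).mul_bdd (c := 2) (hgW k)
      (ae_of_all _ fun ω => hg2 _))).congr (ae_of_all _ fun ω => ?_)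
    simp only [Pi.mul_apply, mul_assoc, he]
  have he0 : ∀ k, ∀ᵐ ω ∂P, 0 ≤ e k ω := fun k => condExp_nonneg (ae_of_all _ fun ω => abs_nonneg _)
  have hsplit : ∀ k, ∫⁻ ω, ‖clarkOcone P X F k ω *
        (D P X k F ω * (g (F ω) - g (F ω - D P X k F ω)))‖ₑ ∂P ≤
      2 * ∫⁻ ω, ‖D P X k (fun ω' => |clarkOcone P X F k ω'|) ω * D P X k F ω‖ₑ ∂P +
        ENNReal.ofReal (∫ ω, e k ω * D P X k F ω * g (F ω) ∂P) := by
    intro k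
    have h1 : ENNReal.ofReal (∫ ω, e k ω * D P X k F ω * g (F ω) ∂P)
        = ∫⁻ ω, ‖e k ω * (D P X k F ω * (g (F ω) - g (F ω - D P X k F ω)))‖ₑ ∂P := by
      have h2 : (fun ω => e k ω * (D P X k F ω * (g (F ω) - g (F ω - D P X k F ω))))
          = fun ω => e k ω * D P X k F ω * g (F ω)
            - D P X k F ω * (e k ω * g (F ω - D P X k F ω)) := by
        funext ω
        ring
      have h3 : ∫ ω, e k ω * (D P X k F ω * (g (F ω) - g (F ω - D P X k F ω))) ∂P
          = ∫ ω, e k ω * D P X k F ω * g (F ω) ∂P := by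
        rw [h2, integral_sub (hi1 k) (hi2 k), h0, sub_zero]
      have hpos : ∀ᵐ ω ∂P,
          0 ≤ e k ω * (D P X k F ω * (g (F ω) - g (F ω - D P X k F ω))) := by
        filter_upwards [he0 k] with ω hω
        exact mul_nonneg hω (hρ k ω)
      rw [← h3, ofReal_integral_eq_lintegral_ofReal (by rw [h2]; exact (hi1 k).sub (hi2 k)) hpos]
      refine lintegral_congr_ae ?_
      filter_upwards [hpos] with ω hω
      rw [Real.enorm_eq_ofReal hω]
    have hDm : AEStronglyMeasurable
        (fun ω => D P X k (fun ω' => |clarkOcone P X F k ω'|) ω * D P X k F ω) P :=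
      (memLp_D k (memLp_clarkOcone hF2 k).abs).1.mul (hd2 k).1
    rw [h1, ← lintegral_const_mul'' _ hDm.enorm, ← lintegral_add_left' (hDm.enorm.const_mul _)]
    refine lintegral_mono fun ω => ?_
    have h4 : ‖clarkOcone P X F k ω‖ₑ
        = ‖D P X k (fun ω' => |clarkOcone P X F k ω'|) ω + e k ω‖ₑ := by
      rw [D, sub_add_cancel, Real.enorm_abs]
    rw [enorm_mul, h4, ← enorm_mul, add_mul]
    refine (enorm_add_le _ _).trans (add_le_add ?_ le_rfl)
    rw [← mul_assoc, enorm_mul, mul_comm]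
    gcongr
    rw [Real.enorm_eq_ofReal_abs]
    exact (ENNReal.ofReal_le_ofReal (hgg _ _)).trans (by simp)
  refine (ENNReal.tsum_le_tsum hsplit).trans ?_
  rw [ENNReal.tsum_add, ENNReal.tsum_mul_left]
  refine add_le_add le_rfl ?_
  have hs := hasSum_integral_mul_bdd hv hsum hgF fun ω => hg2 (F ω)
  -- The integrand itself has no sign; subtracting the term of mean zero makes it nonnegative. This
  -- lets the sum be moved inside `ENNReal.ofReal`.
  have hnn : ∀ k, 0 ≤ ∫ ω, e k ω * D P X k F ω * g (F ω) ∂P := by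
    intro k
    have h5 : ∫ ω, e k ω * D P X k F ω * g (F ω) ∂P
        = ∫ ω, (e k ω * D P X k F ω * g (F ω)
          - D P X k F ω * (e k ω * g (F ω - D P X k F ω))) ∂P := by
      rw [integral_sub (hi1 k) (hi2 k), h0, sub_zero]
    rw [h5]
    refine integral_nonneg_of_ae ?_
    filter_upwards [he0 k] with ω hω
    have := mul_nonneg hω (hρ k ω)
    simp only [Pi.zero_apply]
    linarith
  rw [← ENNReal.ofReal_tsum_of_nonneg hnn hs.summable, hs.tsum_eq]
  refine (Real.ofReal_le_enorm _).trans ?_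
  refine (enorm_integral_mul_bdd_le fun ω => hg2 (F ω)).trans (by simp [he])

end SteinBound

/-! ### From Stein's equation to the two distances. -/

section Distances

lemma abs_integral_sub_le {μ : Measure ℝ} [IsProbabilityMeasure μ] {h h' : ℝ → ℝ}
    (hi : Integrable h μ) (hi' : Integrable h' μ) {c : ℝ} (hc : ∀ x, |h' x - h x| ≤ c) :
    |∫ x, h' x ∂μ - ∫ x, h x ∂μ| ≤ c := by
  rw [← integral_sub hi' hi]
  simpa using norm_integral_le_of_norm_le_const (μ := μ) (f := fun x => h' x - h x)
    (ae_of_all _ hc)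

variable {Ω : Type*} [MeasurableSpace Ω] {P : Measure Ω} [IsProbabilityMeasure P] {F : Ω → ℝ}

/-- Stein's method for the Wasserstein distance. -/
lemma wassersteinDist_le_of_stein (hF : Integrable F P) {b : ℝ≥0∞}
    (hb : ∀ f u : ℝ → ℝ, Continuous f → Continuous u → (∀ x, |f x| ≤ 1) →
      (∀ x, |u x| ≤ Real.sqrt (2 / Real.pi)) → (∀ y d, |f y - f (y - d) - u y * d| ≤ d ^ 2) →
      ‖∫ ω, (u (F ω) - F ω * f (F ω)) ∂P‖ₑ ≤ b) :
    wassersteinDist (P.map F) (gaussianReal 0 1) ≤ b := by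
  have hFm : AEMeasurable F P := hF.1.aemeasurable
  have : IsProbabilityMeasure (P.map F) := Measure.isProbabilityMeasure_map hFm
  have hid : Integrable (fun x => x) (P.map F) :=
    (integrable_map_measure aestronglyMeasurable_id hFm).2 hF
  refine iSup₂_le fun h hL => ?_
  refine ENNReal.le_of_forall_pos_le_add fun ε hε _ => ?_
  -- With ε/4 the smoothing error is ε/2 under each of the two laws, hence ε in total.
  obtain ⟨h', k, l, C, hh, hk, hl, hk1, hlC, happ⟩ :=
    StdGaussian.exists_smooth_approx hL (ε := ε / 4) (by positivity)
  obtain ⟨f, u, hf, hu, hf1, hu1, hst, htay⟩ :=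
    StdGaussian.exists_stein_solution hh hk hl hk1 hlC
  have hL' : ∀ x y, |h x - h y| ≤ |x - y| := fun x y => by
    simpa [Real.dist_eq] using hL.dist_le_mul x y
  have hc' : Continuous h' := continuous_iff_continuousAt.2 fun x => (hh x).continuousAt
  have hLh' := StdGaussian.abs_sub_le_of_deriv hh hk1
  have hi' := StdGaussian.integrable_of_lipschitz hid hc' hLh'
  have e1 := abs_integral_sub_le (StdGaussian.integrable_of_lipschitz hid hL.continuous hL')
    hi' happ
  have e2 := abs_integral_sub_le
    (StdGaussian.integrable_of_lipschitz StdGaussian.integrable_id_gaussian hL.continuous hL')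
    (StdGaussian.integrable_of_deriv_bound hh hk1) happ
  have e3 := hb f u hf hu hf1 hu1 htay
  have e4 : ∫ ω, (u (F ω) - F ω * f (F ω)) ∂P
      = ∫ x, h' x ∂(P.map F) - ∫ z, h' z ∂gaussianReal 0 1 := by
    have hi2 : Integrable (fun ω => h' (F ω)) P :=
      (integrable_map_measure hc'.aestronglyMeasurable hFm).1 hi'
    rw [integral_map hFm hc'.aestronglyMeasurable]
    simp only [hst]
    rw [integral_sub hi2 (integrable_const _)]
    simp
  rw [e4, Real.enorm_eq_ofReal_abs] at e3
  have e5 : (ε : ℝ≥0∞) = ENNReal.ofReal ε := by simp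
  refine le_trans ?_ (add_le_add_left e3 _)
  rw [e5, ← ENNReal.ofReal_add (abs_nonneg _) ε.coe_nonneg]
  refine ENNReal.ofReal_le_ofReal ?_
  rw [abs_le] at e1 e2
  have := le_abs_self (∫ x, h' x ∂(P.map F) - ∫ z, h' z ∂gaussianReal 0 1)
  have := neg_le_abs (∫ x, h' x ∂(P.map F) - ∫ z, h' z ∂gaussianReal 0 1)
  exact abs_le.2 ⟨by linarith, by linarith⟩

/-- Stein's method for the Kolmogorov distance. -/
lemma kolmogorovDist_le_of_stein (hF : AEMeasurable F P) {b : ℝ≥0∞}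
    (hb : ∀ z, ‖∫ ω, (StdGaussian.kolDeriv z (F ω) - F ω * StdGaussian.kolSol z (F ω)) ∂P‖ₑ ≤ b) :
    kolmogorovDist (P.map F) (gaussianReal 0 1) ≤ b := by
  have : IsProbabilityMeasure (P.map F) := Measure.isProbabilityMeasure_map hF
  refine iSup_le fun z => ?_
  rw [← Real.enorm_eq_ofReal_abs]
  refine le_of_eq_of_le ?_ (hb z)
  congr 1
  have h1 : ∀ x, StdGaussian.kolDeriv z x - x * StdGaussian.kolSol z x
      = (Set.Iic z).indicator (fun _ => (1 : ℝ)) x - StdGaussian.tail (-z) := by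
    intro x
    simp only [StdGaussian.kolDeriv, Set.indicator_apply, Set.mem_Iic]
    ring
  have hm : AEStronglyMeasurable (fun x : ℝ => (Set.Iic z).indicator (fun _ => (1 : ℝ)) x
      - StdGaussian.tail (-z)) (P.map F) :=
    ((measurable_const.indicator measurableSet_Iic).sub_const _).aestronglyMeasurable
  simp only [h1]
  rw [← integral_map hF hm, integral_sub ((integrable_const (1 : ℝ)).indicator measurableSet_Iic)
    (integrable_const _), integral_indicator_const _ measurableSet_Iic, StdGaussian.measureReal_Iic]
  simp

end Distances

end ProductMalliavin

/-! ### The Clark-Ocone bounds. -/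

theorem theorem3p6 {Ω : Type*} [MeasurableSpace Ω] (P : Measure Ω) [IsProbabilityMeasure P]
    {E : ℕ → Type*} [∀ n, MeasurableSpace (E n)] (X : ∀ n, Ω → E n)
    (hX : ∀ n, Measurable (X n)) (hindep : iIndepFun X P)
    (F : Ω → ℝ) (hF : ProductMalliavin.MemDomD P X F) (hF0 : ∫ ω, F ω ∂P = 0) :
    -- the two random series converge absolutely, almost surely
    (∀ᵐ ω ∂P, Summable fun k =>
      ProductMalliavin.clarkOcone P X F k ω * ProductMalliavin.D P X k F ω) ∧
    (∀ᵐ ω ∂P, Summable fun k =>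
      (P[fun ω' => |ProductMalliavin.clarkOcone P X F k ω'| |
        ProductMalliavin.sigmaOf X {k}ᶜ]) ω * ProductMalliavin.D P X k F ω) ∧
    -- the Wasserstein bound
    ProductMalliavin.wassersteinDist (P.map F) (gaussianReal 0 1) ≤
      ENNReal.ofReal (Real.sqrt (2 / Real.pi)) *
          (∫⁻ ω, ENNReal.ofReal |1 - ∑' k,
            ProductMalliavin.clarkOcone P X F k ω * ProductMalliavin.D P X k F ω| ∂P) +
        ∑' k, ∫⁻ ω, ENNReal.ofReal
          (|ProductMalliavin.clarkOcone P X F k ω| * (ProductMalliavin.D P X k F ω) ^ 2) ∂P ∧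
    -- the Kolmogorov bound
    ProductMalliavin.kolmogorovDist (P.map F) (gaussianReal 0 1) ≤
      (∫⁻ ω, ENNReal.ofReal |1 - ∑' k,
          ProductMalliavin.clarkOcone P X F k ω * ProductMalliavin.D P X k F ω| ∂P) +
        2 * (∑' k, ∫⁻ ω, ENNReal.ofReal
          |ProductMalliavin.D P X k (fun ω' => |ProductMalliavin.clarkOcone P X F k ω'|) ω *
            ProductMalliavin.D P X k F ω| ∂P) +
        2 * (∫⁻ ω, ENNReal.ofReal |∑' k,
          (P[fun ω' => |ProductMalliavin.clarkOcone P X F k ω'| |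
            ProductMalliavin.sigmaOf X {k}ᶜ]) ω * ProductMalliavin.D P X k F ω| ∂P) := by
  have hFi : Integrable F P := hF.1.2.integrable one_le_two
  have hd := fun k => (ProductMalliavin.memLp_D (X := X) k hF.1.2).1
  simp only [← Real.enorm_eq_ofReal_abs]
  refine ⟨?_, ?_, ?_, ?_⟩
  · exact ProductMalliavin.ae_summable_of_tsum_lintegral
      (fun k => (ProductMalliavin.memLp_clarkOcone hF.1.2 k).1.mul (hd k))
      (ProductMalliavin.tsum_clarkOcone_mul_D_ne_top hX hindep hF)
  · exact ProductMalliavin.ae_summable_of_tsum_lintegral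
      (fun k => (ProductMalliavin.memLp_condExp_abs_clarkOcone hF.1.2 k).1.mul (hd k))
      (ProductMalliavin.tsum_condExp_mul_D_ne_top hX hindep hF)
  · refine ProductMalliavin.wassersteinDist_le_of_stein hFi fun f u hf hu hf1 hu1 htay => ?_
    refine (ProductMalliavin.malliavin_stein_bound hX hindep hF hF0 hf hu.measurable hf1 hu1).trans
      (add_le_add le_rfl (ENNReal.tsum_le_tsum fun k => lintegral_mono fun ω => ?_))
    rw [Real.enorm_eq_ofReal_abs, abs_mul]
    exact ENNReal.ofReal_le_ofReal (mul_le_mul_of_nonneg_left (htay _ _) (abs_nonneg _))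
  · refine ProductMalliavin.kolmogorovDist_le_of_stein hFi.1.aemeasurable fun z => ?_
    refine (ProductMalliavin.malliavin_stein_bound hX hindep hF hF0
      (StdGaussian.continuous_kolSol z) (StdGaussian.measurable_kolDeriv z)
      (StdGaussian.abs_kolSol_le z) (StdGaussian.abs_kolDeriv_le z)).trans ?_
    rw [ENNReal.ofReal_one, one_mul, add_assoc]
    refine add_le_add le_rfl (le_trans (ENNReal.tsum_le_tsum fun k => lintegral_mono fun ω => ?_)
      (ProductMalliavin.kolmogorov_remainder_le hX hindep hF (StdGaussian.monotone_kolMono z)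
        (StdGaussian.abs_kolMono_le z) (StdGaussian.kolMono_sub_le z)))
    rw [enorm_mul, enorm_mul (ProductMalliavin.clarkOcone P X F k ω)]
    gcongr
    rw [Real.enorm_eq_ofReal_abs, Real.enorm_eq_ofReal_abs]
    exact ENNReal.ofReal_le_ofReal ((StdGaussian.abs_kolSol_taylor_le z _ _).trans (le_abs_self _))
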